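/- Let $F$ be a probability distribution on $[0,\infty)$ with finite mean $\mu$ and right tail $\bar F(x)=1-F(x)=\dfrac{2}{\pi\,x\,L(x)}$ for all sufficiently large $x$, where $$L(x)=(\beta_0\log x)^{\delta+1}\,e^{(\beta_1\log x)^{\gamma}},\qquad \beta_0>0,$$ and either (a) $\beta_1>0$, $0<\gamma<1$, $\delta\in\mathbb R$, or (b) $\beta_1=\gamma=0$ and $\delta>0$, in which case $(\beta_1\log x)^\gamma$ is read as $0$. Put $K_{\delta,\gamma,\beta_1}=\dfrac{2}{\pi\,\beta_1^{\gamma}\gamma}$ in case (a) and $K_{\delta,0,0}=\dfrac{2}{\pi\delta}$ in case (b). Let $L^\dagger$ be a de Bruijn conjugate of $L$, i.e. a slowly varying function with $L(xL^\dagger(x))\,L^\dagger(x)\to1$ and $L^\dagger(xL(x))\,L(x)\to1$ as $x\to\infty$. Let $X_1,X_2,\dots$ be independent with distribution $F$. Call $(B_n,A_n)$ scaling and centering sequences if $B_n>0$ for large $n$ and $\frac1{B_n}\sum_{i=1}^nX_i-A_n$ converges in distribution to the stable law with characteristic function $\exp(-|t|-2it\log|t|/\pi)$. Then for all scaling and centering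 sequences $(B_n,A_n)$, $$A_n=\frac{n\mu}{B_n}-K_{\delta,\gamma,\beta_1}\frac{n(\log B_n)^{1-\gamma}}{B_nL(B_n)}\,(1+o(1)).$$ Moreover $B_n=nL^\dagger(n)$ is a scaling sequence (there is a centering sequence that goes with it), and every centering sequence $A_n$ that goes with $B_n=nL^\dagger(n)$ satisfies, as $n\to\infty$, $$A_n=\frac{\mu}{L^\dagger(n)}-K_{\delta,\gamma,\beta_1}\frac{(\log B_n)^{1-\gamma}}{L^\dagger(n)\,L(nL^\dagger(n))}\,(1+o(1)) =\frac{\mu}{L^\dagger(n)}-K_{\delta,\gamma,\beta_1}(\log n)^{1-\gamma}\,(1+o(1)).$$ -/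

import Mathlib

open Filter Topology MeasureTheory ProbabilityTheory

/-- A slowly varying function (at infinity): positive and measurable on some half-line `[a, ∞)`, with
`ℓ (c x) / ℓ x → 1` as `x → ∞` for every `c > 0`.  Values below `a` are irrelevant. -/
def IsSlowlyVarying (ℓ : ℝ → ℝ) : Prop :=
  (∃ a : ℝ, (∀ x ≥ a, 0 < ℓ x) ∧ Measurable fun x : Set.Ici a => ℓ x) ∧
    ∀ c > 0, Tendsto (fun x => ℓ (c * x) / ℓ x) atTop (𝓝 1)

/-- `M` is a (version of the) de Bruijn conjugate of `L`: a slowly varying function with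
`L (x M(x)) M(x) → 1` and `M (x L(x)) L(x) → 1` as `x → ∞`. -/
def IsDeBruijnConjugate (L M : ℝ → ℝ) : Prop :=
  IsSlowlyVarying M ∧
    Tendsto (fun x => L (x * M x) * M x) atTop (𝓝 1) ∧
    Tendsto (fun x => M (x * L x) * L x) atTop (𝓝 1)

/-- `L(x) = (β₀ log x)^(δ+1) exp((β₁ log x)^γ)` for large `x`; the term `(β₁ log x)^γ` is read as `0`
when `β₁ = 0` (in that case `γ = 0`, and the convention `0 ^ 0 = 0` is in force). -/
noncomputable def slowFactor (β₀ β₁ δ γ x : ℝ) : ℝ :=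
  (β₀ * Real.log x) ^ (δ + 1) * Real.exp (if β₁ = 0 then 0 else (β₁ * Real.log x) ^ γ)

/-- The constant `K`, equal to `2 C₁ / (β₁ ^ γ γ)` for `β₁, γ > 0` and to `2 C₁ / δ` for
`β₁ = γ = 0`, where `C₁ = 1 / π`. -/
noncomputable def centeringConst (δ γ β₁ : ℝ) : ℝ :=
  if β₁ = 0 then (2 / Real.pi) / δ else (2 / Real.pi) / (β₁ ^ γ * γ)

/-- `ν` is the maximally skew (`β = 1`) stable law of index `α = 1`, the one whose characteristic
function is `exp (-|t| - 2 i t log |t| / π)`. -/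
def IsSkewCauchyLaw (ν : ProbabilityMeasure ℝ) : Prop :=
  ∀ t : ℝ, charFun (ν : Measure ℝ) t =
    Complex.exp (-(|t| : ℝ) - 2 * Complex.I * (t : ℂ) * (Real.log |t| : ℝ) / (Real.pi : ℝ))

/-- `B` and `A` are stabilizing (scaling and centering) sequences for the partial sums of `X`:
`B n > 0` for large `n`, and `(X₀ + ⋯ + Xₙ₋₁) / Bₙ - Aₙ` converges in distribution to the maximally
skew stable law of index `1`. -/
def IsStabilizing {Ω : Type*} [MeasurableSpace Ω] (P : Measure Ω) [IsProbabilityMeasure P]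
    (X : ℕ → Ω → ℝ) (B A : ℕ → ℝ) : Prop :=
  (∀ᶠ n in atTop, 0 < B n) ∧
    ∃ ν : ProbabilityMeasure ℝ, IsSkewCauchyLaw ν ∧
      TendstoInDistribution (fun (n : ℕ) (ω : Ω) => (∑ i ∈ Finset.range n, X i ω) / B n - A n)
        atTop (id : ℝ → ℝ) (fun _ => P) (ν : Measure ℝ)

/-! Write `L(x) = exp (g (log x))` for large `x`. Since `g' → 0`, the tail `c / (x L(x))` has a
density `f` there. Rescaling by `x` and multiplying by `x L(x)` turns this density into one
converging to `c y⁻²`, under a Potter-type bound. With compensation truncated at `y = 1`, dominated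
convergence gives `x L(x) (φ(t/x) - 1 - i t μ / x) + i t T(x) → c ψ(t)`, where `T(x) = L(x) ∫_x^∞ w
f(w) dw` (`IsNormalizedSlow.tendsto_charFun`). The term `T` is what full compensation by the mean
subtracts beyond the truncation point. For `c = 2 / π`, the exponent `c ψ` is that of the target law
up to a drift (`levyExponent_eq`).

Hence, if `B → ∞` and `n / (B L(B)) → 1`, the centering `n μ / B - n T(B) / (B L(B)) + const` works
(`tendsto_charFun_pow`). Conversely, the moduli of the characteristic functions, which do not see
the centering, force both conditions on `B` (`scaling_of_isStabilizing`), and two centerings for the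
same `B` differ by `o(1)` (`tendsto_sub_of_charFun`).

By l'Hôpital, `T(x)` is asymptotic to `(c / κ) (log x) ^ (1 - γ)` (`tendsto_tailMean_div`). This
diverges, so the constant and the `o(1)` disappear into the relative error. For `B = n L†(n)`, the
first conjugacy relation gives `n / (B L(B)) → 1`; the second gives `B → ∞` and `log B ~ log n`. -/

/-! ### The Lévy–Khintchine exponent of the skew Cauchy law -/

/-- The integrable envelope `y ^ (-1/2)` near zero and `y ^ (-3/2)` near infinity. -/
noncomputable def powerEnvelope (y : ℝ) : ℝ :=
  if y ≤ 1 then y ^ (-(1 / 2) : ℝ) else y ^ (-(3 / 2) : ℝ)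

lemma powerEnvelope_nonneg {y : ℝ} (hy : 0 ≤ y) : 0 ≤ powerEnvelope y := by
  unfold powerEnvelope; split_ifs <;> positivity

lemma integrableOn_powerEnvelope : IntegrableOn powerEnvelope (Set.Ioi 0) := by
  rw [← Set.Ioc_union_Ioi_eq_Ioi zero_le_one]
  refine IntegrableOn.union ?_ ?_
  · have h : IntegrableOn (fun y : ℝ => y ^ (-(1 / 2) : ℝ)) (Set.Ioc 0 1) := by
      rw [← intervalIntegrable_iff_integrableOn_Ioc_of_le zero_le_one]
      exact intervalIntegral.intervalIntegrable_rpow' (by norm_num)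
    refine h.congr_fun (fun y hy => ?_) measurableSet_Ioc
    simp [powerEnvelope, hy.2]
  · have h : IntegrableOn (fun y : ℝ => y ^ (-(3 / 2) : ℝ)) (Set.Ioi 1) :=
      integrableOn_Ioi_rpow_of_lt (by norm_num) one_pos
    refine h.congr_fun (fun y hy => ?_) measurableSet_Ioi
    have hy' : ¬ y ≤ 1 := not_le.2 hy
    simp [powerEnvelope, hy']

lemma one_le_powerEnvelope {y : ℝ} (h0 : 0 < y) (hy : y ≤ 1) : 1 ≤ powerEnvelope y := by
  rw [powerEnvelope, if_pos hy]
  exact Real.one_le_rpow_of_pos_of_le_one_of_nonpos h0 hy (by norm_num)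

lemma inv_sq_le_powerEnvelope {y : ℝ} (hy : 1 < y) : (y ^ 2)⁻¹ ≤ powerEnvelope y := by
  rw [powerEnvelope, if_neg (not_le.2 hy), ← Real.rpow_natCast, ← Real.rpow_neg (by linarith)]
  exact Real.rpow_le_rpow_of_exponent_le hy.le (by norm_num)

/-- Taylor's bound applies for `|x| ≤ 1`, and the triangle inequality gives `2 + |x| ≤ 3 x²`
otherwise; the constant 3 makes one bound serve all `x`. -/
lemma norm_exp_ofReal_mul_I_sub_one_sub_le (x : ℝ) :
    ‖Complex.exp (x * Complex.I) - 1 - x * Complex.I‖ ≤ 3 * x ^ 2 := by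
  rcases le_or_gt |x| 1 with h | h
  · have := Complex.norm_exp_sub_one_sub_id_le (x := x * Complex.I) (by simpa using h)
    simp only [norm_mul, Complex.norm_real, Complex.norm_I, mul_one, Real.norm_eq_abs, sq_abs]
      at this
    nlinarith [sq_nonneg x]
  · have h1 : ‖Complex.exp (x * Complex.I) - 1 - x * Complex.I‖ ≤ 1 + 1 + |x| := by
      refine (norm_sub_le _ _).trans (add_le_add ((norm_sub_le _ _).trans ?_) ?_)
      · simp [Complex.norm_exp_ofReal_mul_I]
      · simp
    nlinarith [sq_abs x]

lemma integral_one_sub_cos_mul_exp_neg {v : ℝ} (hv : 0 < v) :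
    IntegrableOn (fun u : ℝ => (1 - Real.cos u) * (v * Real.exp (-(u * v)))) (Set.Ioi 0) ∧
    ∫ u in Set.Ioi (0 : ℝ), (1 - Real.cos u) * (v * Real.exp (-(u * v))) = (1 + v ^ 2)⁻¹ := by
  have ha : (-(v : ℂ)).re < 0 := by simpa using hv
  have hb : (-(v : ℂ) + Complex.I).re < 0 := by simpa using hv
  have i1 := integrableOn_exp_mul_complex_Ioi ha 0
  have i2 := integrableOn_exp_mul_complex_Ioi hb 0
  have key : ∀ u : ℝ, (1 - Real.cos u) * (v * Real.exp (-(u * v))) =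
      RCLike.re ((v : ℂ) * (Complex.exp (-(v : ℂ) * u) -
        Complex.exp ((-(v : ℂ) + Complex.I) * u))) := by
    intro u
    have e1 : Complex.exp (-(v : ℂ) * u) = ((Real.exp (-(u * v)) : ℝ) : ℂ) := by
      push_cast; ring_nf
    have e2 : Complex.exp ((-(v : ℂ) + Complex.I) * u) =
        ((Real.exp (-(u * v)) : ℝ) : ℂ) * Complex.exp (u * Complex.I) := by
      push_cast; rw [← Complex.exp_add]; ring_nf
    rw [e1, e2, RCLike.re_to_complex, Complex.re_ofReal_mul, Complex.sub_re, Complex.re_ofReal_mul,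
      Complex.exp_ofReal_mul_I_re, Complex.ofReal_re]
    ring
  have i3 := (i1.sub i2).const_mul (v : ℂ)
  simp_rw [key]
  refine ⟨i3.re, ?_⟩
  have : ∫ u in Set.Ioi (0 : ℝ), RCLike.re ((v : ℂ) * (Complex.exp (-(v : ℂ) * u) -
      Complex.exp ((-(v : ℂ) + Complex.I) * u))) = RCLike.re (∫ u in Set.Ioi (0 : ℝ), ((v : ℂ) *
        (Complex.exp (-(v : ℂ) * u) - Complex.exp ((-(v : ℂ) + Complex.I) * u)))) :=
    integral_re i3
  rw [this, integral_const_mul, integral_sub i1 i2, integral_exp_mul_complex_Ioi ha,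
    integral_exp_mul_complex_Ioi hb, RCLike.re_to_complex]
  simp only [Complex.re_ofReal_mul, Complex.ofReal_zero, mul_zero, Complex.exp_zero]
  have hv' : (v : ℂ) ≠ 0 := by exact_mod_cast hv.ne'
  have : 0 < 1 + v ^ 2 := by positivity
  simp [Complex.div_re, Complex.normSq_apply, Complex.sub_re]
  field_simp
  ring

lemma integral_mul_exp_neg_mul {u : ℝ} (hu : 0 < u) :
    ∫ v in Set.Ioi (0 : ℝ), v * Real.exp (-(u * v)) = (u ^ 2)⁻¹ := by
  have := Real.integral_rpow_mul_exp_neg_mul_Ioi (a := 2) (r := u) two_pos hu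
  rw [Real.Gamma_two] at this
  norm_num at this
  exact this

/-- Writing `u⁻² = ∫ v e^{-uv} dv` and applying Fubini leaves `∫ dv / (1 + v²)` over the half-line.
Everything is nonnegative, so the same inner integral also proves joint integrability. -/
theorem integral_one_sub_cos_div_sq :
    ∫ y in Set.Ioi (0 : ℝ), (1 - Real.cos y) / y ^ 2 = Real.pi / 2 := by
  have hint : Integrable (Function.uncurry fun u v : ℝ =>
      (1 - Real.cos u) * (v * Real.exp (-(u * v))))
      ((volume.restrict (Set.Ioi 0)).prod (volume.restrict (Set.Ioi 0))) := by
    rw [integrable_prod_iff' (Measurable.aestronglyMeasurable (by fun_prop))]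
    constructor
    · refine (ae_restrict_iff' measurableSet_Ioi).2 (ae_of_all _ fun v hv => ?_)
      exact (integral_one_sub_cos_mul_exp_neg hv).1
    · refine (integrable_inv_one_add_sq.integrableOn (s := Set.Ioi 0)).congr ?_
      refine (ae_restrict_iff' measurableSet_Ioi).2 (ae_of_all _ fun v hv => ?_)
      simp only [Function.uncurry]
      rw [← (integral_one_sub_cos_mul_exp_neg hv).2]
      refine setIntegral_congr_fun measurableSet_Ioi fun u _ => ?_
      have hv0 : (0 : ℝ) < v := hv
      have : 0 ≤ 1 - Real.cos u := by linarith [Real.cos_le_one u]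
      exact (Real.norm_of_nonneg (by positivity)).symm
  have swap := integral_integral_swap hint
  have lhs : ∫ u in Set.Ioi (0 : ℝ), ∫ v in Set.Ioi (0 : ℝ),
      (1 - Real.cos u) * (v * Real.exp (-(u * v))) =
      ∫ y in Set.Ioi (0 : ℝ), (1 - Real.cos y) / y ^ 2 := by
    refine setIntegral_congr_fun measurableSet_Ioi fun u hu => ?_
    rw [integral_const_mul, integral_mul_exp_neg_mul hu, div_eq_mul_inv]
  have rhs : ∫ v in Set.Ioi (0 : ℝ), ∫ u in Set.Ioi (0 : ℝ),
      (1 - Real.cos u) * (v * Real.exp (-(u * v))) = Real.pi / 2 := by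
    rw [setIntegral_congr_fun measurableSet_Ioi
      (fun v hv => (integral_one_sub_cos_mul_exp_neg hv).2), integral_Ioi_inv_one_add_sq]
    simp
  rw [← lhs, swap, rhs]

/-- The compensated exponential `exp (i t y) - 1 - i t y 1_{y ≤ 1}`. -/
noncomputable def compensatedExp (t y : ℝ) : ℂ :=
  Complex.exp ((t * y : ℝ) * Complex.I) - 1 - ((if y ≤ 1 then t * y else 0 : ℝ) : ℂ) * Complex.I

lemma measurable_compensatedExp (t : ℝ) : Measurable (compensatedExp t) := by
  unfold compensatedExp
  refine Measurable.sub (by fun_prop) (Measurable.mul_const ?_ _)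
  exact Complex.measurable_ofReal.comp
    (Measurable.ite measurableSet_Iic (by fun_prop) measurable_const)

lemma norm_compensatedExp_le_sq {t y : ℝ} (hy : y ≤ 1) :
    ‖compensatedExp t y‖ ≤ 3 * (1 + t ^ 2) * y ^ 2 := by
  rw [compensatedExp, if_pos hy]
  refine (norm_exp_ofReal_mul_I_sub_one_sub_le (t * y)).trans ?_
  nlinarith [sq_nonneg y]

lemma norm_compensatedExp_le {t y : ℝ} (hy : 1 < y) :
    ‖compensatedExp t y‖ ≤ 3 * (1 + t ^ 2) := by
  rw [compensatedExp, if_neg (not_le.2 hy)]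
  have : ‖Complex.exp ((t * y : ℝ) * Complex.I) - 1 - ((0 : ℝ) : ℂ) * Complex.I‖ ≤ 1 + 1 := by
    simp only [Complex.ofReal_zero, zero_mul, sub_zero]
    refine (norm_sub_le _ _).trans ?_
    rw [Complex.norm_exp_ofReal_mul_I]; simp
  nlinarith [sq_nonneg t]

lemma integrableOn_compensatedExp_div_sq (t : ℝ) :
    IntegrableOn (fun y : ℝ => compensatedExp t y / (y ^ 2 : ℝ)) (Set.Ioi 0) := by
  refine Integrable.mono' (integrableOn_powerEnvelope.const_mul (3 * (1 + t ^ 2)))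
    (((measurable_compensatedExp t).div (by fun_prop)).aestronglyMeasurable) ?_
  refine (ae_restrict_iff' measurableSet_Ioi).2 (ae_of_all _ fun y hy => ?_)
  have hy0 : (0 : ℝ) < y := hy
  have hy2 : 0 < y ^ 2 := by positivity
  rw [norm_div, Complex.norm_real, Real.norm_of_nonneg hy2.le]
  rcases le_or_gt y 1 with h | h
  · have := one_le_powerEnvelope hy0 h
    rw [div_le_iff₀ hy2]
    refine (norm_compensatedExp_le_sq h).trans ?_
    have h3 : 0 ≤ 3 * (1 + t ^ 2) := by positivity
    exact mul_le_mul_of_nonneg_right (le_mul_of_one_le_right h3 this) hy2.le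
  · rw [div_eq_mul_inv]
    exact mul_le_mul (norm_compensatedExp_le h) (inv_sq_le_powerEnvelope h) (by positivity)
      (by positivity)

/-- The integral of `exp (i t y) - 1 - i t y 1_{y ≤ 1}` against `y⁻² dy` on the positive half-line. -/
noncomputable def levyExponent (t : ℝ) : ℂ :=
  ∫ y in Set.Ioi (0 : ℝ), compensatedExp t y / (y ^ 2 : ℝ)

lemma levyExponent_zero : levyExponent 0 = 0 := by
  simp [levyExponent, compensatedExp]

lemma levyExponent_neg (t : ℝ) : levyExponent (-t) = (starRingEnd ℂ) (levyExponent t) := by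
  rw [levyExponent, levyExponent, ← integral_conj]
  congr 1; ext y
  simp only [compensatedExp, map_div₀, map_sub, map_mul, Complex.conj_ofReal, map_one,
    Complex.conj_I, ← Complex.exp_conj]
  split_ifs <;> simp

lemma levyExponent_one_re : (levyExponent 1).re = -(Real.pi / 2) := by
  have h := integral_re (integrableOn_compensatedExp_div_sq 1)
  rw [levyExponent, ← RCLike.re_to_complex, ← h, ← integral_one_sub_cos_div_sq, ← integral_neg]
  congr 1; ext y
  rw [RCLike.re_to_complex, Complex.div_ofReal_re, compensatedExp, one_mul]
  simp only [Complex.sub_re, Complex.exp_ofReal_mul_I_re, Complex.one_re, Complex.re_ofReal_mul,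
    Complex.I_re, mul_zero, sub_zero]
  ring

/-- The cost of moving the truncation point under a change of scale; the logarithm in the exponent
comes from here. -/
lemma integral_truncation_shift {t : ℝ} (ht : 0 < t) :
    IntegrableOn (fun u : ℝ => (if u ≤ 1 then u⁻¹ else 0) - (if u ≤ t then u⁻¹ else 0))
      (Set.Ioi 0) ∧
    ∫ u in Set.Ioi (0 : ℝ), ((if u ≤ 1 then u⁻¹ else 0) - (if u ≤ t then u⁻¹ else 0)) =
      -Real.log t := by
  have aux : ∀ a b : ℝ, 0 < a → a ≤ b →
      IntegrableOn (fun u : ℝ => (if u ≤ b then u⁻¹ else 0) - (if u ≤ a then u⁻¹ else 0))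
        (Set.Ioi 0) ∧
      ∫ u in Set.Ioi (0 : ℝ), ((if u ≤ b then u⁻¹ else 0) - (if u ≤ a then u⁻¹ else 0)) =
        Real.log (b / a) := by
    intro a b ha hab
    have heq : Set.EqOn (fun u : ℝ => (if u ≤ b then u⁻¹ else 0) - (if u ≤ a then u⁻¹ else 0))
        ((Set.Ioc a b).indicator fun u => u⁻¹) (Set.Ioi 0) := by
      intro u _
      by_cases h1 : u ≤ a
      · simp [h1, h1.trans hab]
      · by_cases h2 : u ≤ b
        · have : u ∈ Set.Ioc a b := ⟨not_le.1 h1, h2⟩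
          simp [h1, h2, this]
        · simp [h1, h2]
    have hsub : Set.Ioi 0 ∩ Set.Ioc a b = Set.Ioc a b :=
      Set.inter_eq_right.2 fun x hx => ha.trans hx.1
    have hii : IntegrableOn (fun u : ℝ => u⁻¹) (Set.Ioc a b) := by
      rw [← intervalIntegrable_iff_integrableOn_Ioc_of_le hab]
      refine intervalIntegral.intervalIntegrable_inv (fun x hx => ?_) (continuousOn_id)
      rw [Set.uIcc_of_le hab] at hx
      exact (ha.trans_le hx.1).ne'
    constructor
    · refine IntegrableOn.congr_fun ?_ heq.symm measurableSet_Ioi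
      rw [IntegrableOn, integrable_indicator_iff measurableSet_Ioc, IntegrableOn,
        Measure.restrict_restrict measurableSet_Ioc, Set.inter_comm, hsub]
      exact hii
    · rw [setIntegral_congr_fun measurableSet_Ioi heq, setIntegral_indicator measurableSet_Ioc,
        hsub, ← intervalIntegral.integral_of_le hab, integral_inv_of_pos ha (ha.trans_le hab)]
  rcases le_total t 1 with h | h
  · simpa using aux t 1 ht h
  · obtain ⟨h1, h2⟩ := aux 1 t one_pos h
    rw [div_one] at h2
    constructor
    · refine h1.neg.congr (ae_of_all _ fun u => ?_)
      simp
    · rw [← h2, ← integral_neg]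
      simp

/-- Substituting `u = t y` would give homogeneity of degree one, except that the cut-off `y ≤ 1`
becomes `u ≤ t`. -/
lemma levyExponent_of_pos {t : ℝ} (ht : 0 < t) :
    levyExponent t = t * levyExponent 1 - t * Real.log t * Complex.I := by
  obtain ⟨h1, h2⟩ := integral_truncation_shift ht
  -- The exponent at 1 with its cut-off moved from 1 to `t`.
  set h : ℝ → ℂ := fun u => compensatedExp 1 u / (u ^ 2 : ℝ) +
    (((if u ≤ 1 then u⁻¹ else 0) - (if u ≤ t then u⁻¹ else 0) : ℝ) : ℂ) * Complex.I with hh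
  have hpt : ∀ y ∈ Set.Ioi (0 : ℝ),
      compensatedExp t y / (y ^ 2 : ℝ) = ((t : ℂ) ^ 2) * h (t * y) := by
    intro y hy
    have hy0 : (y : ℂ) ≠ 0 := by exact_mod_cast (ne_of_gt hy)
    have ht0 : (t : ℂ) ≠ 0 := by exact_mod_cast ht.ne'
    have e1 : (t * y ≤ t) ↔ y ≤ 1 := by
      constructor
      · intro h; by_contra hc; push Not at hc; nlinarith
      · intro h; nlinarith
    simp only [hh, compensatedExp, one_mul, e1]
    by_cases c1 : t * y ≤ 1 <;> by_cases c2 : y ≤ 1 <;> simp only [c1, c2, if_true, if_false] <;>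
      push_cast <;> field_simp <;> ring
  have hint : ∫ u in Set.Ioi (0 : ℝ), h u = levyExponent 1 - Real.log t * Complex.I := by
    simp only [hh]
    have i2 : IntegrableOn (fun u : ℝ => (((if u ≤ 1 then u⁻¹ else 0) -
        (if u ≤ t then u⁻¹ else 0) : ℝ) : ℂ) * Complex.I) (Set.Ioi 0) := h1.ofReal.mul_const _
    rw [integral_add (integrableOn_compensatedExp_div_sq 1) i2,
      integral_mul_const, integral_complex_ofReal, h2, ← levyExponent]
    push_cast; ring
  rw [levyExponent, setIntegral_congr_fun measurableSet_Ioi hpt, integral_const_mul,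
    integral_comp_mul_left_Ioi h 0 ht, mul_zero, hint, Complex.real_smul]
  have ht0 : (t : ℂ) ≠ 0 := by exact_mod_cast ht.ne'
  push_cast
  field_simp

/-- The centering shift that turns `levyExponent` into the exponent of the skew Cauchy law. -/
noncomputable def skewShift : ℝ := 2 / Real.pi * (levyExponent 1).im

/-- The factor `2 / π` normalizes the real part `-π / 2` at `t = 1`, and the drift cancels the
imaginary part there. Negative `t` follow by conjugation. -/
lemma levyExponent_eq (t : ℝ) :
    ((2 / Real.pi : ℝ) : ℂ) * levyExponent t - t * skewShift * Complex.I =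
      -(|t| : ℝ) - 2 * Complex.I * (t : ℂ) * (Real.log |t| : ℝ) / (Real.pi : ℝ) := by
  have hpi : (Real.pi : ℂ) ≠ 0 := by exact_mod_cast Real.pi_ne_zero
  have h1 : levyExponent 1 = -(Real.pi / 2) + (levyExponent 1).im * Complex.I := by
    conv_lhs => rw [← Complex.re_add_im (levyExponent 1), levyExponent_one_re]
    push_cast; ring
  have pos : ∀ s : ℝ, 0 < s → levyExponent s =
      s * (-(Real.pi / 2) + (levyExponent 1).im * Complex.I) - s * Real.log s * Complex.I := by
    intro s hs
    rw [levyExponent_of_pos hs, ← h1]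
  rcases lt_trichotomy t 0 with h | h | h
  · have h2 := levyExponent_neg (-t)
    rw [neg_neg, pos (-t) (by linarith)] at h2
    rw [h2, abs_of_neg h, skewShift]
    simp only [map_sub, map_mul, map_add, map_neg, map_div₀, Complex.conj_ofReal, Complex.conj_I,
      map_ofNat]
    push_cast
    field_simp
    ring
  · simp [h, levyExponent_zero]
  · rw [pos t h, abs_of_pos h, skewShift]
    push_cast
    field_simp
    ring

/-! ### Normalized slowly varying functions -/

/-- `x ↦ exp (g (log x))` is a normalized slowly varying function from `exp u₀` on, with
index function `g'`: `g` has the continuous derivative `g'` on `[u₀, ∞)`, which tends to zero and is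
at most `1 / 2` in absolute value. -/
structure IsNormalizedSlow (g g' : ℝ → ℝ) (u₀ : ℝ) : Prop where
  hasDerivAt : ∀ u ≥ u₀, HasDerivAt g (g' u) u
  cont : ContinuousOn g' (Set.Ici u₀)
  bound : ∀ u ≥ u₀, |g' u| ≤ 1 / 2
  lim : Tendsto g' atTop (𝓝 0)

namespace IsNormalizedSlow

variable {g g' : ℝ → ℝ} {u₀ : ℝ}

lemma abs_sub_le (h : IsNormalizedSlow g g' u₀) {ε a : ℝ} (ha : u₀ ≤ a)
    (hε : ∀ w ≥ a, |g' w| ≤ ε) {u v : ℝ} (hu : a ≤ u) (hv : a ≤ v) :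
    |g u - g v| ≤ ε * |u - v| :=
  Convex.norm_image_sub_le_of_norm_hasDerivWithin_le (s := Set.Ici a)
    (fun x hx => (h.hasDerivAt x (ha.trans hx)).hasDerivWithinAt) (fun x hx => hε x hx)
    (convex_Ici a) hv hu

lemma eventually_abs_le (h : IsNormalizedSlow g g' u₀) {ε : ℝ} (hε : 0 < ε) :
    ∃ a ≥ u₀, ∀ w ≥ a, |g' w| ≤ ε := by
  have := (Metric.tendsto_nhds.1 h.lim) ε hε
  obtain ⟨a, ha⟩ := eventually_atTop.1 this
  refine ⟨max a u₀, le_max_right _ _, fun w hw => ?_⟩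
  simpa using (ha w ((le_max_left _ _).trans hw)).le

/-- Slow variation in logarithmic coordinates, from the mean value inequality and `g' → 0`. -/
lemma tendsto_shift (h : IsNormalizedSlow g g' u₀) (s : ℝ) :
    Tendsto (fun u => g (u + s) - g u) atTop (𝓝 0) := by
  refine Metric.tendsto_nhds.2 fun ε hε => ?_
  obtain ⟨a, ha, hb⟩ := h.eventually_abs_le (ε := ε / (2 * (|s| + 1))) (by positivity)
  filter_upwards [eventually_ge_atTop a, eventually_ge_atTop (a - s)] with u h1 h2
  have h3 := h.abs_sub_le ha hb (u := u + s) (v := u) (by linarith) h1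
  rw [dist_zero_right, Real.norm_eq_abs]
  refine h3.trans_lt ?_
  rw [add_sub_cancel_left, div_mul_eq_mul_div, div_lt_iff₀ (by positivity)]
  nlinarith [abs_nonneg s]

lemma tendsto_div_id (h : IsNormalizedSlow g g' u₀) :
    Tendsto (fun u => g u / u) atTop (𝓝 0) := by
  refine Metric.tendsto_nhds.2 fun ε hε => ?_
  obtain ⟨a, ha, hb⟩ := h.eventually_abs_le (ε := ε / 2) (by positivity)
  filter_upwards [eventually_ge_atTop a, eventually_gt_atTop 0,
    eventually_gt_atTop (2 * (|g a| + ε / 2 * |a|) / ε)] with u h1 h2 h3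
  have h4 := h.abs_sub_le ha hb (u := u) (v := a) h1 le_rfl
  rw [dist_zero_right, Real.norm_eq_abs, abs_div, abs_of_pos h2, div_lt_iff₀ h2]
  rw [div_lt_iff₀ hε] at h3
  have h5 : |u - a| ≤ u + |a| := by
    rw [abs_of_nonneg (by linarith)]; linarith [neg_abs_le a]
  have h6 : |g u| ≤ |g u - g a| + |g a| := by
    have := abs_add_le (g u - g a) (g a); rwa [sub_add_cancel] at this
  nlinarith

lemma tendsto_add_self (h : IsNormalizedSlow g g' u₀) :
    Tendsto (fun u => u + g u) atTop atTop := by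
  have h1 : Tendsto (fun u : ℝ => u * (1 + g u / u)) atTop atTop :=
    tendsto_id.atTop_mul_pos (C := 1) one_pos (by simpa using h.tendsto_div_id.const_add 1)
  refine h1.congr' ?_
  filter_upwards [eventually_gt_atTop 0] with u hu
  field_simp

lemma tendsto_sub_self (h : IsNormalizedSlow g g' u₀) :
    Tendsto (fun u => g u - u) atTop atBot := by
  have h1 : Tendsto (fun u : ℝ => u * (1 - g u / u)) atTop atTop :=
    tendsto_id.atTop_mul_pos (C := 1) one_pos (by simpa using h.tendsto_div_id.const_sub 1)
  refine (tendsto_neg_atTop_atBot.comp h1).congr' ?_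
  filter_upwards [eventually_gt_atTop 0] with u hu
  simp only [Function.comp]
  field_simp
  ring

lemma tendsto_mul_slow (h : IsNormalizedSlow g g' u₀) :
    Tendsto (fun x => x * Real.exp (g (Real.log x))) atTop atTop := by
  refine (Real.tendsto_exp_atTop.comp (h.tendsto_add_self.comp Real.tendsto_log_atTop)).congr' ?_
  filter_upwards [eventually_gt_atTop 0] with x hx
  simp only [Function.comp]
  rw [Real.exp_add, Real.exp_log hx]

lemma tendsto_slow_div (h : IsNormalizedSlow g g' u₀) :
    Tendsto (fun x => Real.exp (g (Real.log x)) / x) atTop (𝓝 0) := by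
  refine (Real.tendsto_exp_atBot.comp
    (h.tendsto_sub_self.comp Real.tendsto_log_atTop)).congr' ?_
  filter_upwards [eventually_gt_atTop 0] with x hx
  simp only [Function.comp]
  rw [Real.exp_sub, Real.exp_log hx]

end IsNormalizedSlow

/-! ### Tail densities -/

/-- The density of the tail `c / (x L(x))` with `L(x) = exp (g (log x))`. -/
noncomputable def tailDensity (c : ℝ) (g g' : ℝ → ℝ) (x : ℝ) : ℝ :=
  c / (x ^ 2 * Real.exp (g (Real.log x))) * (1 + g' (Real.log x))

namespace IsNormalizedSlow

variable {g g' : ℝ → ℝ} {u₀ c : ℝ}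

lemma le_log (_h : IsNormalizedSlow g g' u₀) {x : ℝ} (hx : Real.exp u₀ ≤ x) :
    u₀ ≤ Real.log x :=
  (Real.le_log_iff_exp_le ((Real.exp_pos _).trans_le hx)).2 hx

lemma tailDensity_nonneg (h : IsNormalizedSlow g g' u₀) (hc : 0 ≤ c) {x : ℝ}
    (hx : Real.exp u₀ ≤ x) : 0 ≤ tailDensity c g g' x := by
  have := abs_le.1 (h.bound _ (h.le_log hx))
  unfold tailDensity
  have : 0 ≤ 1 + g' (Real.log x) := by linarith [this.1]
  positivity

lemma hasDerivAt_slow (h : IsNormalizedSlow g g' u₀) {x : ℝ} (hx : Real.exp u₀ ≤ x) :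
    HasDerivAt (fun x => Real.exp (g (Real.log x)))
      (Real.exp (g (Real.log x)) * (g' (Real.log x) * x⁻¹)) x := by
  have hx0 : 0 < x := (Real.exp_pos _).trans_le hx
  exact ((h.hasDerivAt _ (h.le_log hx)).comp x (Real.hasDerivAt_log hx0.ne')).exp

lemma hasDerivAt_tail (h : IsNormalizedSlow g g' u₀) {x : ℝ} (hx : Real.exp u₀ ≤ x) :
    HasDerivAt (fun x => c / (x * Real.exp (g (Real.log x)))) (-tailDensity c g g' x) x := by
  have hx0 : 0 < x := (Real.exp_pos _).trans_le hx
  have := ((hasDerivAt_id x).mul (h.hasDerivAt_slow hx)).inv (by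
    simp only [Pi.mul_apply, id]; positivity) |>.const_mul c
  refine (this.congr_deriv ?_).congr_of_eventuallyEq ?_
  · simp only [Pi.mul_apply, id, tailDensity]
    field_simp
  · exact Eventually.of_forall fun y => by simp [div_eq_mul_inv]

lemma continuousOn_tailDensity (h : IsNormalizedSlow g g' u₀) :
    ContinuousOn (tailDensity c g g') (Set.Ici (Real.exp u₀)) := by
  have hlog : ContinuousOn Real.log (Set.Ici (Real.exp u₀)) := fun x hx =>
    (Real.continuousAt_log ((Real.exp_pos u₀).trans_le hx).ne').continuousWithinAt
  have h1 : ContinuousOn (fun x => g' (Real.log x)) (Set.Ici (Real.exp u₀)) :=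
    h.cont.comp hlog fun x hx => h.le_log hx
  have h2 : ContinuousOn (fun x => Real.exp (g (Real.log x))) (Set.Ici (Real.exp u₀)) :=
    fun x hx => (h.hasDerivAt_slow hx).continuousAt.continuousWithinAt
  refine (continuousOn_const.div ((continuousOn_id.pow 2).mul h2) fun x hx => ?_).mul
    (continuousOn_const.add h1)
  have : 0 < x := (Real.exp_pos _).trans_le hx
  exact mul_ne_zero (pow_ne_zero 2 this.ne') (Real.exp_pos _).ne'

lemma tail_tendsto (h : IsNormalizedSlow g g' u₀) :
    Tendsto (fun x => c / (x * Real.exp (g (Real.log x)))) atTop (𝓝 0) :=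
  h.tendsto_mul_slow.const_div_atTop c

lemma integrableOn_tailDensity (h : IsNormalizedSlow g g' u₀) (hc : 0 ≤ c) {x : ℝ}
    (hx : Real.exp u₀ ≤ x) : IntegrableOn (tailDensity c g g') (Set.Ioi x) := by
  have := integrableOn_Ioi_deriv_of_nonpos' (a := x)
    (fun y hy => h.hasDerivAt_tail (c := c) (hx.trans hy))
    (fun y hy => neg_nonpos.2 (h.tailDensity_nonneg hc (hx.trans (le_of_lt hy)))) h.tail_tendsto
  simpa using this.neg

lemma integral_tailDensity (h : IsNormalizedSlow g g' u₀) (hc : 0 ≤ c) {x : ℝ}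
    (hx : Real.exp u₀ ≤ x) :
    ∫ y in Set.Ioi x, tailDensity c g g' y = c / (x * Real.exp (g (Real.log x))) := by
  have := integral_Ioi_of_hasDerivAt_of_nonpos' (a := x)
    (fun y hy => h.hasDerivAt_tail (c := c) (hx.trans hy))
    (fun y hy => neg_nonpos.2 (h.tailDensity_nonneg hc (hx.trans (le_of_lt hy)))) h.tail_tendsto
  rw [integral_neg] at this
  linarith

/-- A measure whose tail is `c / (x L(x))` from `exp u₀` on has density `tailDensity c g g'` there. -/
lemma restrict_eq_withDensity (h : IsNormalizedSlow g g' u₀) (hc : 0 ≤ c)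
    {F : Measure ℝ} [IsProbabilityMeasure F]
    (htail : ∀ x ≥ Real.exp u₀, F.real (Set.Ioi x) = c / (x * Real.exp (g (Real.log x)))) :
    F.restrict (Set.Ioi (Real.exp u₀)) = (volume.restrict (Set.Ioi (Real.exp u₀))).withDensity
      (fun x => ENNReal.ofReal (tailDensity c g g' x)) := by
  set μ₁ := F.restrict (Set.Ioi (Real.exp u₀))
  set μ₂ := (volume.restrict (Set.Ioi (Real.exp u₀))).withDensity
      (fun x => ENNReal.ofReal (tailDensity c g g' x))
  have hIoi : ∀ a, μ₁ (Set.Ioi a) = μ₂ (Set.Ioi a) := by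
    intro a
    have hm : Real.exp u₀ ≤ max a (Real.exp u₀) := le_max_right _ _
    rw [Measure.restrict_apply measurableSet_Ioi, withDensity_apply _ measurableSet_Ioi,
      Measure.restrict_restrict measurableSet_Ioi, Set.Ioi_inter_Ioi,
      ← ofReal_integral_eq_lintegral_ofReal (h.integrableOn_tailDensity hc hm),
      h.integral_tailDensity hc hm, ← htail _ hm, ofReal_measureReal]
    exact (ae_restrict_iff' measurableSet_Ioi).2 (ae_of_all _ fun y hy =>
      h.tailDensity_nonneg hc (hm.trans (le_of_lt hy)))
  have huniv : μ₁ Set.univ = μ₂ Set.univ := by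
    have := hIoi (Real.exp u₀)
    simp only [μ₁, μ₂] at this ⊢
    rw [Measure.restrict_apply measurableSet_Ioi, withDensity_apply _ measurableSet_Ioi,
      Measure.restrict_restrict measurableSet_Ioi, Set.inter_self] at this
    rw [Measure.restrict_apply MeasurableSet.univ, withDensity_apply _ MeasurableSet.univ,
      Set.univ_inter, Measure.restrict_univ, this]
  -- Agreement on right rays and equal finite total mass give agreement on left rays, which
  -- determine a finite measure.
  refine Measure.ext_of_Iic _ _ fun a => ?_
  rw [← Set.compl_Ioi, measure_compl measurableSet_Ioi (measure_ne_top _ _),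
    measure_compl measurableSet_Ioi (by rw [← hIoi]; exact measure_ne_top _ _), hIoi, huniv]

end IsNormalizedSlow

/-! ### Potter-type bounds for the rescaled density -/

section Potter

variable {g g' : ℝ → ℝ} {u₀ c : ℝ}

lemma exp_half_abs_log_of_le {y : ℝ} (hy : 0 < y) (h : y ≤ 1) :
    Real.exp (1 / 2 * |Real.log y|) = powerEnvelope y := by
  rw [powerEnvelope, if_pos h, Real.rpow_def_of_pos hy,
    abs_of_nonpos (Real.log_nonpos hy.le h)]
  ring_nf

lemma inv_sq_mul_exp_half_abs_log {y : ℝ} (h : 1 < y) :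
    (y ^ 2)⁻¹ * Real.exp (1 / 2 * |Real.log y|) = powerEnvelope y := by
  have hy : 0 < y := by linarith
  rw [powerEnvelope, if_neg (not_le.2 h), abs_of_nonneg (Real.log_nonneg h.le),
    show (-(3 / 2) : ℝ) = -(2 : ℕ) + 1 / 2 by norm_num, Real.rpow_add hy, Real.rpow_neg hy.le,
    Real.rpow_natCast, Real.rpow_def_of_pos hy (1 / 2)]
  ring_nf

/-- The density `tailDensity c g g'` rescaled by `B`. -/
noncomputable def rescaledDensity (c : ℝ) (g g' : ℝ → ℝ) (B y : ℝ) : ℝ :=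
  B ^ 2 * Real.exp (g (Real.log B)) * tailDensity c g g' (B * y)

lemma rescaledDensity_eq {B y : ℝ} (hB : 0 < B) (hy : 0 < y) :
    rescaledDensity c g g' B y = c * (y ^ 2)⁻¹ *
      Real.exp (-(g (Real.log B + Real.log y) - g (Real.log B))) *
      (1 + g' (Real.log B + Real.log y)) := by
  rw [rescaledDensity, tailDensity, Real.log_mul hB.ne' hy.ne', neg_sub, Real.exp_sub]
  field_simp

lemma IsNormalizedSlow.tendsto_rescaledDensity (h : IsNormalizedSlow g g' u₀) {y : ℝ}
    (hy : 0 < y) :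
    Tendsto (fun B => rescaledDensity c g g' B y) atTop (𝓝 (c * (y ^ 2)⁻¹)) := by
  have h1 : Tendsto (fun B => Real.exp (-(g (Real.log B + Real.log y) - g (Real.log B))))
      atTop (𝓝 1) := by
    have := (Real.continuous_exp.tendsto (-0)).comp
      ((h.tendsto_shift (Real.log y)).comp Real.tendsto_log_atTop).neg
    simpa [Function.comp_def] using this
  have h2 : Tendsto (fun B => 1 + g' (Real.log B + Real.log y)) atTop (𝓝 (1 + 0)) :=
    (h.lim.comp (tendsto_atTop_add_const_right _ _ Real.tendsto_log_atTop)).const_add 1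
  have := (h1.const_mul (c * (y ^ 2)⁻¹)).mul h2
  simp only [mul_one, add_zero] at this
  refine this.congr' ?_
  filter_upwards [eventually_gt_atTop 0] with B hB
  rw [rescaledDensity_eq hB hy]

/-- Because `|g'| ≤ 1 / 2`, the ratio `L(B) / L(B y)` is at most `max (y, 1/y) ^ (1/2)`. This loss
leaves the compensated integrand integrable both at zero and at infinity. -/
lemma IsNormalizedSlow.abs_rescaledDensity_le (h : IsNormalizedSlow g g' u₀) (hc : 0 ≤ c)
    {B y : ℝ} (hB : Real.exp u₀ ≤ B) (hy : 0 < y) (hBy : Real.exp u₀ ≤ B * y) :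
    |rescaledDensity c g g' B y| ≤
      2 * c * ((y ^ 2)⁻¹ * Real.exp (1 / 2 * |Real.log y|)) := by
  have hB0 : 0 < B := (Real.exp_pos _).trans_le hB
  have h1 := h.le_log hB
  have h2 := h.le_log hBy
  rw [Real.log_mul hB0.ne' hy.ne'] at h2
  have h3 := h.abs_sub_le le_rfl h.bound h2 h1
  have h4 := h.bound _ h2
  rw [add_sub_cancel_left] at h3
  rw [rescaledDensity_eq hB0 hy, abs_mul, abs_mul, abs_of_nonneg (by positivity : 0 ≤ c * (y ^ 2)⁻¹),
    abs_of_pos (Real.exp_pos _)]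
  have h5 : |1 + g' (Real.log B + Real.log y)| ≤ 2 := by
    rw [abs_le] at h4 ⊢; constructor <;> linarith
  have h6 : Real.exp (-(g (Real.log B + Real.log y) - g (Real.log B))) ≤
      Real.exp (1 / 2 * |Real.log y|) :=
    Real.exp_le_exp.2 ((neg_le_abs _).trans h3)
  calc c * (y ^ 2)⁻¹ * Real.exp (-(g (Real.log B + Real.log y) - g (Real.log B))) *
        |1 + g' (Real.log B + Real.log y)|
      ≤ c * (y ^ 2)⁻¹ * Real.exp (1 / 2 * |Real.log y|) * 2 := by gcongr
    _ = _ := by ring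

end Potter

/-! ### Expansion of the characteristic function near zero -/

section Expansion

variable {g g' : ℝ → ℝ} {u₀ c : ℝ}

lemma IsNormalizedSlow.norm_rescaledDensity_mul_compensatedExp_le (h : IsNormalizedSlow g g' u₀)
    (hc : 0 ≤ c) (t : ℝ) {B y : ℝ} (hB : Real.exp u₀ ≤ B) (hy : 0 < y)
    (hBy : Real.exp u₀ ≤ B * y) :
    ‖(rescaledDensity c g g' B y : ℂ) * compensatedExp t y‖ ≤
      2 * c * (3 * (1 + t ^ 2)) * powerEnvelope y := by
  have h1 := h.abs_rescaledDensity_le hc hB hy hBy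
  rw [norm_mul, Complex.norm_real, Real.norm_eq_abs]
  rcases le_or_gt y 1 with hy1 | hy1
  · rw [exp_half_abs_log_of_le hy hy1] at h1
    have h2 := norm_compensatedExp_le_sq (t := t) hy1
    have h3 := powerEnvelope_nonneg hy.le
    calc _ ≤ 2 * c * ((y ^ 2)⁻¹ * powerEnvelope y) * (3 * (1 + t ^ 2) * y ^ 2) := by gcongr
      _ = _ := by field_simp
  · rw [inv_sq_mul_exp_half_abs_log hy1] at h1
    have h2 := norm_compensatedExp_le (t := t) hy1
    have h3 := powerEnvelope_nonneg hy.le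
    calc _ ≤ 2 * c * powerEnvelope y * (3 * (1 + t ^ 2)) := by gcongr
      _ = _ := by ring

/-- Dominated convergence with the power envelope. Indicators put the integrals on the fixed
half-line, and the moving lower limit `exp u₀ / B` eventually falls below each `y > 0`. -/
lemma IsNormalizedSlow.tendsto_integral_rescaledDensity (h : IsNormalizedSlow g g' u₀)
    (hc : 0 ≤ c) (t : ℝ) :
    Tendsto (fun B => ∫ y in Set.Ioi (Real.exp u₀ / B),
      (rescaledDensity c g g' B y : ℂ) * compensatedExp t y) atTop (𝓝 (c * levyExponent t)) := by
  have hlim : (c : ℂ) * levyExponent t =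
      ∫ y in Set.Ioi (0 : ℝ), ((c * (y ^ 2)⁻¹ : ℝ) : ℂ) * compensatedExp t y := by
    rw [levyExponent, ← integral_const_mul]
    congr 1; ext y; push_cast; ring
  have hind : ∀ᶠ B in atTop, ∫ y in Set.Ioi (0 : ℝ), (Set.Ioi (Real.exp u₀ / B)).indicator
      (fun y => (rescaledDensity c g g' B y : ℂ) * compensatedExp t y) y =
      ∫ y in Set.Ioi (Real.exp u₀ / B),
        (rescaledDensity c g g' B y : ℂ) * compensatedExp t y := by
    filter_upwards [eventually_gt_atTop 0] with B hB
    rw [setIntegral_indicator measurableSet_Ioi, Set.inter_eq_right.2]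
    exact Set.Ioi_subset_Ioi (by positivity)
  rw [hlim]
  refine Tendsto.congr' hind ?_
  refine tendsto_integral_filter_of_dominated_convergence
    (fun y => 2 * c * (3 * (1 + t ^ 2)) * powerEnvelope y) ?_ ?_
    (integrableOn_powerEnvelope.const_mul _) ?_
  · filter_upwards [eventually_gt_atTop 0] with B hB
    rw [aestronglyMeasurable_indicator_iff measurableSet_Ioi,
      Measure.restrict_restrict measurableSet_Ioi, Set.inter_eq_left.2
        (Set.Ioi_subset_Ioi (by positivity))]
    refine AEStronglyMeasurable.mul ?_ (measurable_compensatedExp t).aestronglyMeasurable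
    refine Complex.continuous_ofReal.comp_aestronglyMeasurable ?_
    refine ContinuousOn.aestronglyMeasurable ?_ measurableSet_Ioi
    refine continuousOn_const.mul (h.continuousOn_tailDensity.comp (by fun_prop) fun y hy => ?_)
    have : Real.exp u₀ / B < y := hy
    rw [div_lt_iff₀ hB, mul_comm] at this
    exact this.le
  · filter_upwards [eventually_ge_atTop (Real.exp u₀)] with B hB
    have hB0 : 0 < B := (Real.exp_pos _).trans_le hB
    refine (ae_restrict_iff' measurableSet_Ioi).2 (ae_of_all _ fun y hy => ?_)
    by_cases hm : y ∈ Set.Ioi (Real.exp u₀ / B)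
    · rw [Set.indicator_of_mem hm]
      have : Real.exp u₀ / B < y := hm
      rw [div_lt_iff₀ hB0, mul_comm] at this
      exact h.norm_rescaledDensity_mul_compensatedExp_le hc t hB hy this.le
    · rw [Set.indicator_of_notMem hm, norm_zero]
      have := powerEnvelope_nonneg (le_of_lt hy)
      positivity
  · refine (ae_restrict_iff' measurableSet_Ioi).2 (ae_of_all _ fun y hy => ?_)
    have h1 : Tendsto (fun B => (rescaledDensity c g g' B y : ℂ) * compensatedExp t y) atTop
        (𝓝 (((c * (y ^ 2)⁻¹ : ℝ) : ℂ) * compensatedExp t y)) :=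
      ((Complex.continuous_ofReal.tendsto _).comp (h.tendsto_rescaledDensity hy)).mul_const _
    refine h1.congr' ?_
    have h2 : Tendsto (fun B => Real.exp u₀ / B) atTop (𝓝 0) := tendsto_const_nhds.div_atTop tendsto_id
    filter_upwards [h2.eventually_lt_const hy] with B hB
    rw [Set.indicator_of_mem]
    exact hB

/-- The integrated tail `L(x) ∫_x^∞ w f(w) dw`. -/
noncomputable def tailMean (c : ℝ) (g g' : ℝ → ℝ) (x : ℝ) : ℝ :=
  Real.exp (g (Real.log x)) * ∫ w in Set.Ioi x, w * tailDensity c g g' w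

variable {F : Measure ℝ} [IsProbabilityMeasure F]

lemma IsNormalizedSlow.integrable_iff (h : IsNormalizedSlow g g' u₀) (hc : 0 ≤ c)
    (htail : ∀ x ≥ Real.exp u₀, F.real (Set.Ioi x) = c / (x * Real.exp (g (Real.log x))))
    {E : Type*} [NormedAddCommGroup E] [NormedSpace ℝ E] (f : ℝ → E) :
    (IntegrableOn f (Set.Ioi (Real.exp u₀)) F ↔
      IntegrableOn (fun x => tailDensity c g g' x • f x) (Set.Ioi (Real.exp u₀))) ∧
    ∫ x in Set.Ioi (Real.exp u₀), f x ∂F =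
      ∫ x in Set.Ioi (Real.exp u₀), tailDensity c g g' x • f x := by
  have hmeas : AEMeasurable (fun x => ENNReal.ofReal (tailDensity c g g' x))
      (volume.restrict (Set.Ioi (Real.exp u₀))) :=
    ((h.continuousOn_tailDensity.mono Set.Ioi_subset_Ici_self).aemeasurable
      measurableSet_Ioi).ennreal_ofReal
  have hlt : ∀ᵐ x ∂(volume.restrict (Set.Ioi (Real.exp u₀))),
      ENNReal.ofReal (tailDensity c g g' x) < ⊤ := ae_of_all _ fun x => ENNReal.ofReal_lt_top
  have hto : ∀ x ∈ Set.Ioi (Real.exp u₀), (ENNReal.ofReal (tailDensity c g g' x)).toReal • f x =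
      tailDensity c g g' x • f x := fun x hx => by
    rw [ENNReal.toReal_ofReal (h.tailDensity_nonneg hc (le_of_lt hx))]
  constructor
  · rw [IntegrableOn, h.restrict_eq_withDensity hc htail,
      integrable_withDensity_iff_integrable_smul₀' hmeas hlt]
    exact integrableOn_congr_fun hto measurableSet_Ioi
  · rw [h.restrict_eq_withDensity hc htail,
      integral_withDensity_eq_integral_toReal_smul₀ hmeas hlt]
    exact setIntegral_congr_fun measurableSet_Ioi hto

lemma integrable_compensated (hmean : Integrable (fun x : ℝ => x) F) (s : ℝ) :
    Integrable (fun w : ℝ => Complex.exp ((s * w : ℝ) * Complex.I) - 1 -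
      ((s * w : ℝ) : ℂ) * Complex.I) F := by
  refine Integrable.sub (Integrable.sub ?_ (integrable_const 1)) ?_
  · refine Integrable.mono' (integrable_const (1 : ℝ))
      (Continuous.aestronglyMeasurable (by fun_prop)) (ae_of_all _ fun w => ?_)
    rw [Complex.norm_exp_ofReal_mul_I]
  · exact ((hmean.const_mul s).ofReal).mul_const _

lemma charFun_sub_one_sub (hmean : Integrable (fun x : ℝ => x) F) (s : ℝ) :
    charFun F s - 1 - ((s * ∫ w, w ∂F : ℝ) : ℂ) * Complex.I =
      ∫ w, (Complex.exp ((s * w : ℝ) * Complex.I) - 1 - ((s * w : ℝ) : ℂ) * Complex.I) ∂F := by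
  have i1 : Integrable (fun w : ℝ => Complex.exp ((s * w : ℝ) * Complex.I)) F := by
    refine Integrable.mono' (integrable_const (1 : ℝ))
      (Continuous.aestronglyMeasurable (by fun_prop)) (ae_of_all _ fun w => ?_)
    rw [Complex.norm_exp_ofReal_mul_I]
  have i2 : Integrable (fun w : ℝ => ((s * w : ℝ) : ℂ) * Complex.I) F :=
    ((hmean.const_mul s).ofReal).mul_const _
  have i3 : Integrable (fun w : ℝ => Complex.exp ((s * w : ℝ) * Complex.I) - 1) F :=
    i1.sub (integrable_const 1)
  rw [integral_sub i3 i2, integral_sub i1 (integrable_const 1),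
    integral_mul_const, integral_complex_ofReal, integral_const_mul, charFun_apply_real]
  simp

/-- Substitute `w = x y` and split the full compensator at `y = 1`: its part beyond 1 is the
integrated tail. -/
lemma IsNormalizedSlow.integral_compensated_Ioi (h : IsNormalizedSlow g g' u₀) (hc : 0 ≤ c)
    (hmean : Integrable (fun x : ℝ => x) F)
    (htail : ∀ x ≥ Real.exp u₀, F.real (Set.Ioi x) = c / (x * Real.exp (g (Real.log x))))
    (t : ℝ) {x : ℝ} (hx : Real.exp u₀ ≤ x) :
    ((x * Real.exp (g (Real.log x)) : ℝ) : ℂ) * ∫ w in Set.Ioi (Real.exp u₀),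
      (Complex.exp ((t / x * w : ℝ) * Complex.I) - 1 - ((t / x * w : ℝ) : ℂ) * Complex.I) ∂F =
    (∫ y in Set.Ioi (Real.exp u₀ / x), (rescaledDensity c g g' x y : ℂ) * compensatedExp t y) -
      ((t * tailMean c g g' x : ℝ) : ℂ) * Complex.I := by
  have hx0 : 0 < x := (Real.exp_pos _).trans_le hx
  obtain ⟨hi, he⟩ := h.integrable_iff hc htail (fun w : ℝ =>
    (Complex.exp ((t / x * w : ℝ) * Complex.I) - 1 - ((t / x * w : ℝ) : ℂ) * Complex.I))
  have i1 := hi.1 (integrable_compensated hmean (t / x)).integrableOn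
  have i2 : IntegrableOn (fun w => w * tailDensity c g g' w) (Set.Ioi (Real.exp u₀)) := by
    have := (h.integrable_iff hc htail (fun w : ℝ => w)).1.1 hmean.integrableOn
    simpa [mul_comm] using this
  -- The part of the compensator that the truncation at `w = x` discards.
  set T : ℝ → ℂ := fun w => (((Set.Ioi x).indicator
    (fun w => t / x * (w * tailDensity c g g' w)) w : ℝ) : ℂ) * Complex.I with hT
  have i3 : IntegrableOn T (Set.Ioi (Real.exp u₀)) :=
    (((i2.const_mul (t / x)).indicator measurableSet_Ioi).ofReal).mul_const _
  have hpt : ∀ w : ℝ, tailDensity c g g' w •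
      (Complex.exp ((t / x * w : ℝ) * Complex.I) - 1 - ((t / x * w : ℝ) : ℂ) * Complex.I) =
      (tailDensity c g g' (x * (x⁻¹ * w)) : ℂ) * compensatedExp t (x⁻¹ * w) - T w := by
    intro w
    have e1 : x * (x⁻¹ * w) = w := by field_simp
    have e2 : t * (x⁻¹ * w) = t / x * w := by field_simp
    rw [e1, compensatedExp, e2, Complex.real_smul, hT]
    by_cases hw : w ≤ x
    · have : x⁻¹ * w ≤ 1 := by rw [inv_mul_le_iff₀ hx0]; linarith
      simp [this, hw]
    · have h1 : ¬ x⁻¹ * w ≤ 1 := by rw [inv_mul_le_iff₀ hx0]; linarith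
      have h2 : w ∈ Set.Ioi x := not_le.1 hw
      simp only [h1, if_false, Set.indicator_of_mem h2]
      push_cast; ring
  have i4 : IntegrableOn (fun w => (tailDensity c g g' (x * (x⁻¹ * w)) : ℂ) *
      compensatedExp t (x⁻¹ * w)) (Set.Ioi (Real.exp u₀)) := by
    refine (i1.add i3).congr (ae_of_all _ fun w => ?_)
    simp only [Pi.add_apply, hpt w, sub_add_cancel]
  have hTint : ∫ w in Set.Ioi (Real.exp u₀), T w =
      ((t / x * ∫ w in Set.Ioi x, w * tailDensity c g g' w : ℝ) : ℂ) * Complex.I := by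
    rw [hT, integral_mul_const, integral_complex_ofReal, setIntegral_indicator measurableSet_Ioi,
      Set.inter_eq_right.2 (Set.Ioi_subset_Ioi hx), integral_const_mul]
  have hsub := integral_comp_mul_left_Ioi
    (fun y => (tailDensity c g g' (x * y) : ℂ) * compensatedExp t y) (Real.exp u₀) (inv_pos.2 hx0)
  rw [he]
  simp_rw [hpt]
  rw [integral_sub i4 i3, hsub, hTint, tailMean, inv_inv, ← div_eq_inv_mul, Complex.real_smul,
    mul_sub, ← mul_assoc, ← integral_const_mul]
  have hx1 : (x : ℂ) ≠ 0 := by exact_mod_cast hx0.ne'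
  congr 1
  · congr 1; ext y
    simp only [rescaledDensity]
    push_cast; ring
  · push_cast; field_simp

/-- The mass on `[0, exp u₀]`, where nothing is known about `F`, contributes `O(x⁻²)` to the
compensated integral, hence `O(L(x) / x)` after scaling. The rest is the rescaled density integral.
-/
theorem IsNormalizedSlow.tendsto_charFun (h : IsNormalizedSlow g g' u₀) (hc : 0 ≤ c)
    (hpos : F (Set.Iio 0) = 0) (hmean : Integrable (fun x : ℝ => x) F)
    (htail : ∀ x ≥ Real.exp u₀, F.real (Set.Ioi x) = c / (x * Real.exp (g (Real.log x))))
    (t : ℝ) :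
    Tendsto (fun x : ℝ => ((x * Real.exp (g (Real.log x)) : ℝ) : ℂ) *
        (charFun F (t / x) - 1 - ((t / x * ∫ w, w ∂F : ℝ) : ℂ) * Complex.I) +
        ((t * tailMean c g g' x : ℝ) : ℂ) * Complex.I) atTop (𝓝 (c * levyExponent t)) := by
  set J : ℝ → ℂ := fun x => ((x * Real.exp (g (Real.log x)) : ℝ) : ℂ) *
    ∫ w in Set.Iic (Real.exp u₀), (Complex.exp ((t / x * w : ℝ) * Complex.I) - 1 -
      ((t / x * w : ℝ) : ℂ) * Complex.I) ∂F with hJ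
  have hJ0 : Tendsto J atTop (𝓝 0) := by
    have h1 := h.tendsto_slow_div.const_mul (3 * t ^ 2 * Real.exp u₀ ^ 2)
    rw [mul_zero] at h1
    refine squeeze_zero_norm' ?_ h1
    filter_upwards [eventually_gt_atTop 0] with x hx
    have hae : ∀ᵐ w ∂F, 0 ≤ w := by
      rw [ae_iff]; simpa [Set.Iio] using hpos
    have h2 : ‖∫ w in Set.Iic (Real.exp u₀), (Complex.exp ((t / x * w : ℝ) * Complex.I) - 1 -
      ((t / x * w : ℝ) : ℂ) * Complex.I) ∂F‖ ≤ 3 * (t / x * Real.exp u₀) ^ 2 *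
        F.real (Set.Iic (Real.exp u₀)) := by
      refine norm_setIntegral_le_of_norm_le_const_ae' (measure_lt_top _ _) ?_
      filter_upwards [hae] with w hw hw2
      refine (norm_exp_ofReal_mul_I_sub_one_sub_le _).trans ?_
      have hw3 : w ≤ Real.exp u₀ := hw2
      rw [mul_pow, mul_pow]
      gcongr
    have h3 : F.real (Set.Iic (Real.exp u₀)) ≤ 1 := measureReal_le_one
    rw [hJ, norm_mul, Complex.norm_real, Real.norm_of_nonneg (by positivity)]
    calc _ ≤ x * Real.exp (g (Real.log x)) * (3 * (t / x * Real.exp u₀) ^ 2 * 1) := by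
          gcongr
          exact h2.trans (by gcongr)
      _ = _ := by field_simp
  have key := hJ0.add (h.tendsto_integral_rescaledDensity hc t)
  rw [zero_add] at key
  refine key.congr' ?_
  filter_upwards [eventually_ge_atTop (Real.exp u₀)] with x hx
  have hint := integrable_compensated hmean (t / x)
  rw [charFun_sub_one_sub hmean, ← integral_add_compl (measurableSet_Iic (a := Real.exp u₀)) hint,
    Set.compl_Iic, mul_add, h.integral_compensated_Ioi hc hmean htail t hx]
  simp only [hJ]
  ring

end Expansion

/-! ### Asymptotics of the integrated tail -/

section TailMean

variable {g g' : ℝ → ℝ} {u₀ c : ℝ}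

lemma IsNormalizedSlow.hasDerivAt_integral_Ioi (h : IsNormalizedSlow g g' u₀)
    (hint : IntegrableOn (fun w => w * tailDensity c g g' w) (Set.Ioi (Real.exp u₀)))
    {x : ℝ} (hx : Real.exp u₀ < x) :
    HasDerivAt (fun x => ∫ w in Set.Ioi x, w * tailDensity c g g' w)
      (-(x * tailDensity c g g' x)) x := by
  have hcont : ContinuousOn (fun w => w * tailDensity c g g' w) (Set.Ioi (Real.exp u₀)) :=
    continuousOn_id.mul (h.continuousOn_tailDensity.mono Set.Ioi_subset_Ici_self)
  have h1 : IntervalIntegrable (fun w => w * tailDensity c g g' w) volume (Real.exp u₀) x :=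
    (intervalIntegrable_iff_integrableOn_Ioc_of_le hx.le).2
      (hint.mono_set Set.Ioc_subset_Ioi_self)
  have h2 := intervalIntegral.integral_hasDerivAt_right h1
    (hcont.stronglyMeasurableAtFilter isOpen_Ioi x hx) (hcont.continuousAt (Ioi_mem_nhds hx))
  refine (h2.const_sub (∫ w in Set.Ioi (Real.exp u₀), w * tailDensity c g g' w)
    ).congr_of_eventuallyEq ?_
  filter_upwards [Ioi_mem_nhds hx] with y hy
  rw [← intervalIntegral.integral_interval_add_Ioi hint
    (hint.mono_set (Set.Ioi_subset_Ioi (le_of_lt hy)))]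
  ring

lemma tendsto_integral_Ioi_zero {f : ℝ → ℝ} {a : ℝ} (hint : IntegrableOn f (Set.Ioi a)) :
    Tendsto (fun x => ∫ w in Set.Ioi x, f w) atTop (𝓝 0) := by
  have h1 := (intervalIntegral_tendsto_integral_Ioi a hint tendsto_id).const_sub
    (∫ w in Set.Ioi a, f w)
  rw [sub_self] at h1
  refine h1.congr' ?_
  filter_upwards [eventually_ge_atTop a] with x hx
  rw [← intervalIntegral.integral_interval_add_Ioi hint (hint.mono_set (Set.Ioi_subset_Ioi hx))]
  simp

/-- If `u ^ (1 - γ) (g' u - (1 - γ) / u) → κ > 0` then `L(x) ∫_x^∞ w f(w) dw` is asymptotic to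
`(c / κ) (log x) ^ (1 - γ)`. -/
theorem IsNormalizedSlow.tendsto_tailMean_div (h : IsNormalizedSlow g g' u₀)
    (hint : IntegrableOn (fun w => w * tailDensity c g g' w) (Set.Ioi (Real.exp u₀)))
    {γ κ : ℝ} (hκ : 0 < κ)
    (hg' : Tendsto (fun u => u ^ (1 - γ) * (g' u - (1 - γ) / u)) atTop (𝓝 κ))
    (hzero : Tendsto (fun u => u ^ (1 - γ) * Real.exp (-g u)) atTop (𝓝 0)) :
    Tendsto (fun x => tailMean c g g' x / Real.log x ^ (1 - γ)) atTop (𝓝 (c / κ)) := by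
  have hlog := Real.tendsto_log_atTop
  -- The comparison function `(log x) ^ (1 - γ) / L(x)`. It and the tail integral both vanish at
  -- infinity, and the factor `1 / (x L(x))` cancels in the quotient of their derivatives.
  set G : ℝ → ℝ := fun x => Real.log x ^ (1 - γ) * Real.exp (-g (Real.log x))
  set G' : ℝ → ℝ := fun x => -(Real.log x ^ (1 - γ) * (g' (Real.log x) - (1 - γ) / Real.log x)) *
    Real.exp (-g (Real.log x)) / x
  have hG : ∀ᶠ x in atTop, HasDerivAt G (G' x) x := by
    filter_upwards [eventually_gt_atTop 0, hlog.eventually_gt_atTop 0,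
      hlog.eventually_ge_atTop u₀] with x h0 h1 h2
    have d1 : HasDerivAt (fun u => u ^ (1 - γ) * Real.exp (-g u))
        (((1 - γ) * Real.log x ^ (1 - γ - 1)) * Real.exp (-g (Real.log x)) +
          Real.log x ^ (1 - γ) * (Real.exp (-g (Real.log x)) * (-g' (Real.log x))))
        (Real.log x) :=
      (Real.hasDerivAt_rpow_const (Or.inl h1.ne')).mul (h.hasDerivAt _ h2).neg.exp
    refine (d1.comp x (Real.hasDerivAt_log h0.ne')).congr_deriv ?_
    simp only [G', Real.rpow_sub_one h1.ne']
    field_simp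
    ring
  have hpos : ∀ᶠ x in atTop, 0 < Real.log x ^ (1 - γ) * (g' (Real.log x) - (1 - γ) / Real.log x) :=
    (hg'.comp hlog).eventually_const_lt hκ
  have hlim := HasDerivAt.lhopital_zero_atTop (g := G) (g' := G') (l := 𝓝 (c / κ))
    (f := fun x => ∫ w in Set.Ioi x, w * tailDensity c g g' w)
    (f' := fun x => -(x * tailDensity c g g' x)) ?_ hG ?_ (tendsto_integral_Ioi_zero hint)
    (hzero.comp hlog) ?_
  · refine hlim.congr fun x => ?_
    simp only [tailMean, G, Real.exp_neg]
    field_simp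
  · filter_upwards [eventually_gt_atTop (Real.exp u₀)] with x hx
    exact h.hasDerivAt_integral_Ioi hint hx
  · filter_upwards [hpos, eventually_gt_atTop 0] with x hx h0
    simp only [G']
    exact div_ne_zero (mul_ne_zero (neg_ne_zero.2 hx.ne') (Real.exp_pos _).ne') h0.ne'
  · have h1 : Tendsto (fun x => c * (1 + g' (Real.log x)) /
        (Real.log x ^ (1 - γ) * (g' (Real.log x) - (1 - γ) / Real.log x))) atTop
        (𝓝 (c * (1 + 0) / κ)) :=
      (((h.lim.comp hlog).const_add 1).const_mul c).div (hg'.comp hlog) hκ.ne'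
    rw [add_zero, mul_one] at h1
    refine h1.congr' ?_
    filter_upwards [hpos, eventually_gt_atTop 0] with x hx h0
    simp only [tailDensity, G', Real.exp_neg]
    have := hx.ne'
    have e : Real.exp (g (Real.log x)) ≠ 0 := (Real.exp_pos _).ne'
    generalize Real.log x ^ (1 - γ) * (g' (Real.log x) - (1 - γ) / Real.log x) = q at *
    field_simp

end TailMean

/-! ### Convergence of the characteristic functions of the normalized sums -/

lemma norm_exp_neg_mul_I_sub_one_le (x : ℝ) :
    ‖Complex.exp (-(x : ℂ) * Complex.I) - 1‖ ≤ |x| := by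
  have := Real.norm_exp_I_mul_ofReal_sub_one_le (x := -x)
  rw [mul_comm] at this
  simpa using this

lemma norm_charFun_sub_one_le {F : Measure ℝ} [IsProbabilityMeasure F]
    (hmean : Integrable (fun x : ℝ => x) F) (s : ℝ) :
    ‖charFun F s - 1‖ ≤ |s| * ∫ w, |w| ∂F := by
  have i1 : Integrable (fun w : ℝ => Complex.exp ((s * w : ℝ) * Complex.I)) F := by
    refine Integrable.mono' (integrable_const (1 : ℝ))
      (Continuous.aestronglyMeasurable (by fun_prop)) (ae_of_all _ fun w => ?_)
    rw [Complex.norm_exp_ofReal_mul_I]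
  have h1 : charFun F s - 1 = ∫ w, (Complex.exp ((s * w : ℝ) * Complex.I) - 1) ∂F := by
    rw [integral_sub i1 (integrable_const 1), charFun_apply_real]
    simp
  rw [h1, ← integral_const_mul]
  refine norm_integral_le_of_norm_le (hmean.norm.const_mul _) (ae_of_all _ fun w => ?_)
  have := norm_exp_neg_mul_I_sub_one_le (-(s * w))
  rw [abs_neg, abs_mul] at this
  simpa using this

section Sequence

variable {g g' : ℝ → ℝ} {u₀ c : ℝ} {F : Measure ℝ} [IsProbabilityMeasure F]

lemma IsNormalizedSlow.tendsto_natCast_div_sq (h : IsNormalizedSlow g g' u₀) {B : ℕ → ℝ}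
    (hB : Tendsto B atTop atTop)
    (hBn : Tendsto (fun n : ℕ => n / (B n * Real.exp (g (Real.log (B n))))) atTop (𝓝 1)) :
    Tendsto (fun n : ℕ => n / B n ^ 2) atTop (𝓝 0) := by
  have := hBn.mul (h.tendsto_slow_div.comp hB)
  rw [mul_zero] at this
  refine this.congr' ?_
  filter_upwards [hB.eventually_gt_atTop 0] with n hn
  simp only [Function.comp]
  field_simp

/-- The centering `n μ / Bₙ - n / (Bₙ L(Bₙ)) · L(Bₙ) ∫_{Bₙ}^∞ w f(w) dw + a`. -/
noncomputable def tailCentering (c : ℝ) (g g' : ℝ → ℝ) (F : Measure ℝ) (B : ℕ → ℝ) (a : ℝ)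
    (n : ℕ) : ℝ :=
  n * (∫ w, w ∂F) / B n - n / (B n * Real.exp (g (Real.log (B n)))) * tailMean c g g' (B n) + a

/-- The phase is spread over the `n` factors, so the expression is an `n`-th power of `φ e` with `e
= exp (-i t A / n)`, and it suffices to find the limit of `n (φ e - 1)`. Second-order terms vanish
because `n / B² → 0`. -/
theorem IsNormalizedSlow.tendsto_charFun_pow (h : IsNormalizedSlow g g' u₀) (hc : 0 ≤ c)
    (hpos : F (Set.Iio 0) = 0) (hmean : Integrable (fun x : ℝ => x) F)
    (htail : ∀ x ≥ Real.exp u₀, F.real (Set.Ioi x) = c / (x * Real.exp (g (Real.log x))))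
    {B : ℕ → ℝ} (hB : Tendsto B atTop atTop)
    (hBn : Tendsto (fun n : ℕ => n / (B n * Real.exp (g (Real.log (B n))))) atTop (𝓝 1))
    (a t : ℝ) :
    Tendsto (fun n : ℕ => charFun F (t / B n) ^ n *
      Complex.exp (-((t * tailCentering c g g' F B a n : ℝ) : ℂ) * Complex.I)) atTop
      (𝓝 (Complex.exp (c * levyExponent t - t * a * Complex.I))) := by
  set m := ∫ w, w ∂F with hm
  set A := tailCentering c g g' F B a with hA
  set φ : ℕ → ℂ := fun n => charFun F (t / B n) with hφ
  set e : ℕ → ℂ := fun n => Complex.exp (-((t * A n / n : ℝ) : ℂ) * Complex.I) with he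
  have hBpos := hB.eventually_gt_atTop 0
  have hnB := h.tendsto_natCast_div_sq hB hBn
  have hint : IntegrableOn (fun w => w * tailDensity c g g' w) (Set.Ioi (Real.exp u₀)) := by
    have := (h.integrable_iff hc htail (fun w : ℝ => w)).1.1 hmean.integrableOn
    simpa [mul_comm] using this
  have hI := (tendsto_integral_Ioi_zero hint).comp hB
  -- the centering is negligible to second order
  have hAsq : Tendsto (fun n : ℕ => n * (A n / n) ^ 2) atTop (𝓝 0) := by
    have h1 : Tendsto (fun n : ℕ => 2 * (n / B n ^ 2 *
        (m - ∫ w in Set.Ioi (B n), w * tailDensity c g g' w) ^ 2) + 2 * (a ^ 2 / (n : ℝ)))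
        atTop (𝓝 0) := by
      have h2 := ((hnB.mul ((hI.const_sub m).pow 2)).const_mul 2).add
        ((tendsto_natCast_atTop_atTop (R := ℝ)).const_div_atTop (a ^ 2) |>.const_mul 2)
      simpa using h2
    refine squeeze_zero' (Eventually.of_forall fun n => by positivity) ?_ h1
    filter_upwards [hBpos, eventually_gt_atTop 0] with n hn hn0
    have hn1 : (0 : ℝ) < n := by exact_mod_cast hn0
    have e1 : A n / n = (m - ∫ w in Set.Ioi (B n), w * tailDensity c g g' w) / B n + a / n := by
      simp only [hA, tailCentering, tailMean, ← hm]
      field_simp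
    rw [e1]
    have e2 : ∀ p q : ℝ, (n : ℝ) * (p + q) ^ 2 ≤ 2 * (n * p ^ 2) + 2 * (n * q ^ 2) := by
      intro p q; nlinarith [mul_nonneg hn1.le (sq_nonneg (p - q))]
    refine (e2 _ _).trans (le_of_eq ?_)
    field_simp
  have hφsq : Tendsto (fun n : ℕ => n * ‖φ n - 1‖ ^ 2) atTop (𝓝 0) := by
    have h1 := hnB.mul_const ((|t| * ∫ w, |w| ∂F) ^ 2)
    rw [zero_mul] at h1
    refine squeeze_zero' (Eventually.of_forall fun n => by positivity) ?_ h1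
    filter_upwards [hBpos] with n hn
    have := norm_charFun_sub_one_le hmean (t / B n)
    rw [abs_div, abs_of_pos hn] at this
    calc (n : ℝ) * ‖φ n - 1‖ ^ 2 ≤ n * (|t| / B n * ∫ w, |w| ∂F) ^ 2 := by gcongr
      _ = _ := by field_simp
  have hesq : Tendsto (fun n : ℕ => n * ‖e n - 1‖ ^ 2) atTop (𝓝 0) := by
    have h1 := hAsq.const_mul (t ^ 2)
    rw [mul_zero] at h1
    refine squeeze_zero' (Eventually.of_forall fun n => by positivity) ?_ h1
    refine Eventually.of_forall fun n => ?_
    have := norm_exp_neg_mul_I_sub_one_le (t * A n / n)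
    calc (n : ℝ) * ‖e n - 1‖ ^ 2 ≤ n * |t * A n / n| ^ 2 := by gcongr
      _ = t ^ 2 * (n * (A n / n) ^ 2) := by rw [sq_abs]; ring
  -- The cross term is dominated by the two squares above.
  have hprod : Tendsto (fun n : ℕ => (n : ℂ) * ((φ n - 1) * (e n - 1))) atTop (𝓝 0) := by
    have h1 := hφsq.add hesq
    rw [add_zero] at h1
    refine squeeze_zero_norm (fun n => ?_) h1
    rw [norm_mul, norm_mul, Complex.norm_natCast, ← mul_add]
    gcongr
    nlinarith [sq_nonneg (‖φ n - 1‖ - ‖e n - 1‖), sq_nonneg (‖φ n - 1‖),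
      sq_nonneg (‖e n - 1‖)]
  have hsecond : Tendsto (fun n : ℕ => (n : ℂ) * (e n - 1 + ((t * A n / n : ℝ) : ℂ) * Complex.I))
      atTop (𝓝 0) := by
    have h1 := hAsq.const_mul (3 * t ^ 2)
    rw [mul_zero] at h1
    refine squeeze_zero_norm (fun n => ?_) h1
    have := norm_exp_ofReal_mul_I_sub_one_sub_le (-(t * A n / n))
    have e1 : e n - 1 + ((t * A n / n : ℝ) : ℂ) * Complex.I =
        Complex.exp (((-(t * A n / n) : ℝ) : ℂ) * Complex.I) - 1 -
          ((-(t * A n / n) : ℝ) : ℂ) * Complex.I := by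
      simp only [he]; push_cast; ring
    rw [norm_mul, Complex.norm_natCast, e1]
    calc (n : ℝ) * _ ≤ n * (3 * (-(t * A n / n)) ^ 2) := by gcongr
      _ = _ := by ring
  have hmain := (Complex.continuous_ofReal.tendsto 1 |>.comp hBn).mul
    ((h.tendsto_charFun hc hpos hmean htail t).comp hB)
  rw [Complex.ofReal_one, one_mul] at hmain
  have htotal : Tendsto (fun n : ℕ => (n : ℂ) * (φ n * e n - 1)) atTop
      (𝓝 (c * levyExponent t - t * a * Complex.I)) := by
    have h1 := ((hmain.sub_const (t * a * Complex.I)).add hsecond).add hprod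
    rw [add_zero, add_zero] at h1
    refine h1.congr' ?_
    filter_upwards [hBpos, eventually_gt_atTop 0] with n hn hn0
    have hn1 : (n : ℂ) ≠ 0 := by exact_mod_cast hn0.ne'
    have hL : ((Real.exp (g (Real.log (B n))) : ℝ) : ℂ) ≠ 0 := by
      exact_mod_cast (Real.exp_pos _).ne'
    have hBc : (B n : ℂ) ≠ 0 := by exact_mod_cast hn.ne'
    have eA : ((A n : ℝ) : ℂ) = n * m / B n - n / (B n * (Real.exp (g (Real.log (B n))) : ℝ)) *
        (tailMean c g g' (B n) : ℝ) + a := by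
      simp only [hA, tailCentering, ← hm]; push_cast; ring
    simp only [Function.comp, ← hm]
    rw [show charFun F (t / B n) = φ n from rfl]
    push_cast at eA hL ⊢
    rw [eA]
    field_simp
    ring
  have hpow := Complex.tendsto_one_add_pow_exp_of_tendsto htotal
  refine hpow.congr' ?_
  filter_upwards [eventually_gt_atTop 0] with n hn0
  have hn1 : (n : ℂ) ≠ 0 := by exact_mod_cast hn0.ne'
  rw [add_sub_cancel, mul_pow, ← Complex.exp_nat_mul]
  congr 2
  push_cast
  field_simp

end Sequence

/-! ### Stabilizing sequences and characteristic functions -/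

/-- The characteristic function of the skew Cauchy law. -/
noncomputable def skewCauchyCharFun (t : ℝ) : ℂ :=
  Complex.exp (-(|t| : ℝ) - 2 * Complex.I * (t : ℂ) * (Real.log |t| : ℝ) / (Real.pi : ℝ))

lemma skewCauchyCharFun_ne_zero (t : ℝ) : skewCauchyCharFun t ≠ 0 := Complex.exp_ne_zero _

lemma norm_skewCauchyCharFun (t : ℝ) : ‖skewCauchyCharFun t‖ = Real.exp (-|t|) := by
  have e : (-(|t| : ℝ) - 2 * Complex.I * (t : ℂ) * (Real.log |t| : ℝ) / (Real.pi : ℝ) : ℂ) =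
      ((-|t| : ℝ) : ℂ) + ((-(2 * t * Real.log |t| / Real.pi) : ℝ) : ℂ) * Complex.I := by
    push_cast; ring
  rw [skewCauchyCharFun, Complex.norm_exp, e]
  simp

lemma continuous_skewCauchyCharFun : Continuous skewCauchyCharFun := by
  have h : Continuous fun t : ℝ => t * Real.log |t| := by
    simpa [Real.log_abs] using Real.continuous_mul_log
  have e : skewCauchyCharFun = fun t : ℝ => Complex.exp (-(|t| : ℝ) - 2 * Complex.I *
      ((t * Real.log |t| : ℝ) : ℂ) / (Real.pi : ℝ)) := by
    ext t; rw [skewCauchyCharFun]; congr 1; push_cast; ring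
  rw [e]
  fun_prop

/-- Probability measures whose characteristic functions converge to a continuous function
have a weak cluster point with that characteristic function. -/
theorem exists_probabilityMeasure_charFun_eq {μ : ℕ → ProbabilityMeasure ℝ} {f : ℝ → ℂ}
    (hf : ContinuousAt f 0)
    (h : ∀ t, Tendsto (fun n => charFun (μ n : Measure ℝ) t) atTop (𝓝 (f t))) :
    ∃ ν : ProbabilityMeasure ℝ, ∀ t, charFun (ν : Measure ℝ) t = f t := by
  have htight : IsTightMeasureSet (Set.range fun n => (μ n : Measure ℝ)) :=
    isTightMeasureSet_of_tendsto_charFun hf h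
  have hcomp : IsCompact (closure (Set.range μ)) := by
    refine isCompact_closure_of_isTightMeasureSet ?_
    convert htight using 1
    ext m; simp
  -- Prokhorov compactness is used along a free ultrafilter, so no subsequence has to be extracted.
  obtain ⟨ν, -, hν⟩ := hcomp.ultrafilter_le_nhds ((hyperfilter ℕ).map μ) (by
    rw [le_principal_iff]
    exact Ultrafilter.mem_map.2 (univ_mem' fun n => subset_closure ⟨n, rfl⟩))
  refine ⟨ν, fun t => tendsto_nhds_unique (f := fun n => charFun (μ n : Measure ℝ) t)
    (l := (hyperfilter ℕ : Filter ℕ)) ?_ ((h t).mono_left (Nat.hyperfilter_le_atTop))⟩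
  have h1 : Tendsto μ (hyperfilter ℕ) (𝓝 ν) := hν
  rw [ProbabilityMeasure.tendsto_iff_forall_integral_rclike_tendsto ℂ] at h1
  simp_rw [charFun_eq_integral_innerProbChar]
  exact h1 _

/-! ### Characteristic functions of normalized i.i.d. sums -/

section

variable {Ω : Type*} [MeasurableSpace Ω] {P : Measure Ω} {X : ℕ → Ω → ℝ} {F : Measure ℝ}

lemma aemeasurable_normalizedSum (hlaw : ∀ i, HasLaw (X i) F P) (n : ℕ) (b a : ℝ) :
    AEMeasurable (fun ω => (∑ i ∈ Finset.range n, X i ω) / b - a) P :=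
  ((Finset.aemeasurable_fun_sum _ fun i _ => (hlaw i).aemeasurable).div_const b).sub_const a

lemma charFun_normalizedSum [IsProbabilityMeasure P] (hindep : iIndepFun X P) (hlaw : ∀ i, HasLaw (X i) F P)
    (n : ℕ) (b a t : ℝ) :
    charFun (P.map fun ω => (∑ i ∈ Finset.range n, X i ω) / b - a) t =
      charFun F (t / b) ^ n * Complex.exp (-((t * a : ℝ) : ℂ) * Complex.I) := by
  have hS : AEMeasurable (fun ω => ∑ i ∈ Finset.range n, X i ω) P :=
    Finset.aemeasurable_fun_sum _ fun i _ => (hlaw i).aemeasurable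
  have e1 : (fun ω => (∑ i ∈ Finset.range n, X i ω) / b - a) =
      (fun x : ℝ => x + -a) ∘ fun ω => b⁻¹ * ∑ i ∈ Finset.range n, X i ω := by
    ext ω; simp [div_eq_inv_mul, sub_eq_add_neg]
  rw [e1, ← AEMeasurable.map_map_of_aemeasurable (by fun_prop) (hS.const_mul _),
    charFun_map_add_const, charFun_map_mul_comp hS,
    (hindep.restrict _).charFun_map_fun_finsetSum_eq_prod (fun i _ => (hlaw i).aemeasurable)]
  simp only [(hlaw _).map_eq, Finset.prod_const, Finset.card_range, Pi.pow_apply]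
  congr 2
  · rw [div_eq_inv_mul]
  · simp

/-- Lévy's continuity theorem. In the reverse direction the limit law must itself be produced; it
arises as a cluster point of the laws of the normalized sums. -/
theorem isStabilizing_iff [IsProbabilityMeasure P] (hindep : iIndepFun X P) (hlaw : ∀ i, HasLaw (X i) F P)
    {B A : ℕ → ℝ} :
    IsStabilizing P X B A ↔ (∀ᶠ n in atTop, 0 < B n) ∧ ∀ t : ℝ,
      Tendsto (fun n => charFun F (t / B n) ^ n *
        Complex.exp (-((t * A n : ℝ) : ℂ) * Complex.I)) atTop (𝓝 (skewCauchyCharFun t)) := by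
  set μ : ℕ → ProbabilityMeasure ℝ := fun n =>
    ⟨P.map fun ω => (∑ i ∈ Finset.range n, X i ω) / B n - A n,
      Measure.isProbabilityMeasure_map (aemeasurable_normalizedSum hlaw n (B n) (A n))⟩
  have hμ : ∀ n t, charFun (μ n : Measure ℝ) t = charFun F (t / B n) ^ n *
      Complex.exp (-((t * A n : ℝ) : ℂ) * Complex.I) := fun n t =>
    charFun_normalizedSum hindep hlaw n (B n) (A n) t
  unfold IsStabilizing
  refine and_congr_right fun _ => ?_
  constructor
  · rintro ⟨ν, hν, hd⟩ t
    have h1 := ProbabilityMeasure.tendsto_iff_tendsto_charFun.1 hd.tendsto t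
    simp only [Measure.map_id, ProbabilityMeasure.coe_mk, hν t] at h1
    exact h1.congr fun n => hμ n t
  · intro h
    have h' : ∀ t, Tendsto (fun n => charFun (μ n : Measure ℝ) t) atTop
        (𝓝 (skewCauchyCharFun t)) := fun t => (h t).congr fun n => (hμ n t).symm
    obtain ⟨ν, hν⟩ := exists_probabilityMeasure_charFun_eq
      continuous_skewCauchyCharFun.continuousAt h'
    refine ⟨ν, hν, ⟨fun n => aemeasurable_normalizedSum hlaw n (B n) (A n), by fun_prop, ?_⟩⟩
    refine ProbabilityMeasure.tendsto_iff_tendsto_charFun.2 fun t => ?_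
    simp only [Measure.map_id, ProbabilityMeasure.coe_mk]
    rw [hν t]
    exact h' t

end

/-! ### Consequences of characteristic functions tending to one -/

/-- The mass outside `[-r, r]` is controlled by the average of `1 - φ` over `[-2/r, 2/r]`, which
vanishes by bounded convergence. -/
lemma tendsto_measureReal_abs_gt_of_charFun {μ : ℕ → Measure ℝ} [∀ n, IsProbabilityMeasure (μ n)]
    (h : ∀ t, Tendsto (fun n => charFun (μ n) t) atTop (𝓝 1)) {r : ℝ} (hr : 0 < r) :
    Tendsto (fun n => (μ n).real {x | r < |x|}) atTop (𝓝 0) := by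
  have h1 : Tendsto (fun n => ∫ t in (-2 * r⁻¹)..(2 * r⁻¹), 1 - charFun (μ n) t) atTop
      (𝓝 (∫ t in (-2 * r⁻¹)..(2 * r⁻¹), (1 : ℂ) - 1)) := by
    refine intervalIntegral.tendsto_integral_filter_of_dominated_convergence (fun _ => 2)
      (Eventually.of_forall fun n => Measurable.aestronglyMeasurable (by fun_prop))
      (Eventually.of_forall fun n => ae_of_all _ fun t _ => norm_one_sub_charFun_le_two)
      (by simp) (ae_of_all _ fun t _ => (h t).const_sub 1)
  have h2 := h1.norm.const_mul (2⁻¹ * r)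
  simp only [sub_self, intervalIntegral.integral_zero, norm_zero, mul_zero] at h2
  exact squeeze_zero (fun n => measureReal_nonneg)
    (fun n => measureReal_abs_gt_le_integral_charFun hr) h2

/-- Applied to Dirac masses, whose mass outside an interval is 0 or 1, the preceding estimate avoids
any choice of a branch of the logarithm. -/
lemma tendsto_zero_of_exp_mul_I {d : ℕ → ℝ}
    (h : ∀ t : ℝ, Tendsto (fun n => Complex.exp (((t * d n : ℝ) : ℂ) * Complex.I)) atTop (𝓝 1)) :
    Tendsto d atTop (𝓝 0) := by
  have h1 : ∀ t : ℝ, Tendsto (fun n => charFun (Measure.dirac (d n)) t) atTop (𝓝 1) := by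
    intro t
    refine (h t).congr fun n => ?_
    rw [charFun_dirac]; simp
  refine Metric.tendsto_nhds.2 fun ε hε => ?_
  have h2 := tendsto_measureReal_abs_gt_of_charFun h1 (half_pos hε)
  filter_upwards [h2.eventually_lt_const one_pos] with n hn
  rw [dist_zero_right, Real.norm_eq_abs]
  by_contra hc
  have hmem : d n ∈ {x : ℝ | ε / 2 < |x|} := by
    simp only [Set.mem_ofPred_eq]; linarith
  rw [measureReal_def, Measure.dirac_apply_of_mem hmem] at hn
  simp at hn

/-- In the quotient of the two limits the common factor `u n t` cancels, leaving only the phase `t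
(A - A')`. -/
lemma tendsto_sub_of_charFun {u : ℕ → ℝ → ℂ} {χ : ℝ → ℂ} {A A' : ℕ → ℝ} (hχ : ∀ t, χ t ≠ 0)
    (h : ∀ t : ℝ, Tendsto (fun n => u n t * Complex.exp (-((t * A n : ℝ) : ℂ) * Complex.I)) atTop
      (𝓝 (χ t)))
    (h' : ∀ t : ℝ, Tendsto (fun n => u n t * Complex.exp (-((t * A' n : ℝ) : ℂ) * Complex.I)) atTop
      (𝓝 (χ t))) :
    Tendsto (fun n => A n - A' n) atTop (𝓝 0) := by
  refine tendsto_zero_of_exp_mul_I fun t => ?_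
  have h1 := (h' t).div (h t) (hχ t)
  rw [div_self (hχ t)] at h1
  refine h1.congr' ?_
  filter_upwards [(h t).eventually_ne (hχ t)] with n hn
  have hu : u n t ≠ 0 := left_ne_zero_of_mul hn
  rw [Pi.div_apply, mul_div_mul_left _ _ hu, ← Complex.exp_sub]
  congr 1; push_cast; ring

/-! ### Symmetrization and divergence of the scaling -/

/-- The symmetrization of `F`, i.e. the law of the difference of two independent copies. -/
noncomputable def symmetrization (F : Measure ℝ) : Measure ℝ := F ∗ F.map (fun x => -1 * x)

section

variable {F : Measure ℝ} [IsProbabilityMeasure F]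

instance : IsProbabilityMeasure (symmetrization F) := by
  have : IsProbabilityMeasure (F.map (fun x => -1 * x)) :=
    Measure.isProbabilityMeasure_map (by fun_prop)
  unfold symmetrization; infer_instance

lemma charFun_symmetrization (t : ℝ) :
    charFun (symmetrization F) t = ((‖charFun F t‖ ^ 2 : ℝ) : ℂ) := by
  have : IsProbabilityMeasure (F.map (fun x => -1 * x)) :=
    Measure.isProbabilityMeasure_map (by fun_prop)
  rw [symmetrization, charFun_conv, charFun_map_mul, neg_one_mul, charFun_neg, Complex.mul_conj,
    Complex.normSq_eq_norm_sq]

/-- If `‖φ(t / Bₙ)‖ → 1` for all `t` and `‖φ‖` is not identically one then `Bₙ → ∞`. -/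
lemma tendsto_atTop_of_norm_charFun {B : ℕ → ℝ} (hB : ∀ᶠ n in atTop, 0 < B n)
    (h : ∀ t, Tendsto (fun n => ‖charFun F (t / B n)‖) atTop (𝓝 1))
    (hF : ∃ t, ‖charFun F t‖ ≠ 1) : Tendsto B atTop atTop := by
  by_contra hnot
  rw [tendsto_atTop] at hnot
  push Not at hnot
  obtain ⟨C, hC⟩ := hnot
  have hC' : ∃ᶠ n in atTop, B n < C := hC.mono fun n hn => by linarith
  have hCpos : 0 < C := by
    obtain ⟨n, h1, h2⟩ := (hC'.and_eventually hB).exists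
    linarith
  -- Only moduli are controlled, and `‖φ‖²` is the characteristic function of the symmetrization.
  set Q := symmetrization F
  have hp : ∀ n, IsProbabilityMeasure (Q.map (fun x => (B n)⁻¹ * x)) := fun n =>
    Measure.isProbabilityMeasure_map (by fun_prop)
  have hone : ∀ t, Tendsto (fun n => charFun (Q.map (fun x => (B n)⁻¹ * x)) t) atTop (𝓝 1) := by
    intro t
    have h1 := (Complex.continuous_ofReal.tendsto _).comp ((h t).pow 2)
    simp only [one_pow, Complex.ofReal_one] at h1
    refine h1.congr fun n => ?_
    rw [charFun_map_mul, charFun_symmetrization, ← div_eq_inv_mul]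
    rfl
  -- At the infinitely many `n` with `B n < C`, rescaling carries `|x| > r` into `|x| > r / C`,
  -- where the mass tends to zero. Thus `Q` is concentrated at 0 and `‖φ‖` is identically one.
  have hnull : ∀ r > 0, Q {x | r < |x|} = 0 := by
    intro r hr
    have h1 := tendsto_measureReal_abs_gt_of_charFun hone (div_pos hr hCpos)
    have h2 : ∃ᶠ n in atTop, Q.real {x | r < |x|} ≤
        (Q.map (fun x => (B n)⁻¹ * x)).real {x | r / C < |x|} := by
      refine (hC'.and_eventually hB).mono fun n hn => ?_
      rw [map_measureReal_apply (by fun_prop) (measurableSet_lt (by fun_prop) (by fun_prop))]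
      refine measureReal_mono fun x hx => ?_
      simp only [Set.mem_ofPred_eq, Set.mem_preimage] at hx ⊢
      rw [abs_mul, abs_inv, abs_of_pos hn.2, ← div_eq_inv_mul]
      exact div_lt_div₀ hx hn.1.le (abs_nonneg x) hn.2
    have h3 : Q.real {x | r < |x|} ≤ 0 := by
      by_contra hc
      push Not at hc
      obtain ⟨n, h4, h5⟩ := (h2.and_eventually (h1.eventually_lt_const hc)).exists
      linarith
    exact (measureReal_eq_zero_iff).1 (le_antisymm h3 measureReal_nonneg)
  have hae : ∀ᵐ x ∂Q, x = 0 := by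
    have h1 : ∀ᵐ x ∂Q, ∀ k : ℕ, ¬ (1 / ((k : ℝ) + 1) < |x|) := by
      rw [ae_all_iff]
      intro k
      rw [ae_iff]
      simpa using hnull (1 / ((k : ℝ) + 1)) (by positivity)
    filter_upwards [h1] with x hx
    by_contra hne
    obtain ⟨k, hk⟩ := exists_nat_one_div_lt (abs_pos.2 hne)
    exact hx k hk
  obtain ⟨t, ht⟩ := hF
  have h1 : charFun Q t = 1 := by
    rw [charFun_apply_real, integral_congr_ae (g := fun _ => (1 : ℂ))]
    · simp
    · filter_upwards [hae] with x hx
      simp [hx]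
  rw [charFun_symmetrization] at h1
  have h2 : ‖charFun F t‖ ^ 2 = 1 := by exact_mod_cast h1
  exact ht ((pow_eq_one_iff_of_nonneg (norm_nonneg _) two_ne_zero).1 h2)

end

/-! ### Scaling and centering sequences -/

section Scaling

variable {g g' : ℝ → ℝ} {u₀ c : ℝ} {F : Measure ℝ} [IsProbabilityMeasure F]

/-- The mean and integrated-tail terms are purely imaginary, so they drop out of the real part of
the expansion at `t = 1`. The remaining term `‖φ - 1‖²` is `O(x⁻²)`. -/
lemma IsNormalizedSlow.tendsto_one_sub_norm_sq (h : IsNormalizedSlow g g' u₀) (hc : 0 ≤ c)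
    (hpos : F (Set.Iio 0) = 0) (hmean : Integrable (fun x : ℝ => x) F)
    (htail : ∀ x ≥ Real.exp u₀, F.real (Set.Ioi x) = c / (x * Real.exp (g (Real.log x)))) :
    Tendsto (fun x : ℝ => x * Real.exp (g (Real.log x)) * (1 - ‖charFun F (1 / x)‖ ^ 2)) atTop
      (𝓝 (c * Real.pi)) := by
  have h1 := (Complex.continuous_re.tendsto _).comp (h.tendsto_charFun hc hpos hmean htail 1)
  have e1 : ((c : ℂ) * levyExponent 1).re = -(c * Real.pi / 2) := by
    rw [Complex.re_ofReal_mul, levyExponent_one_re]; ring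
  rw [e1] at h1
  have h2 : Tendsto (fun x : ℝ => x * Real.exp (g (Real.log x)) * ‖charFun F (1 / x) - 1‖ ^ 2)
      atTop (𝓝 0) := by
    have h3 := h.tendsto_slow_div.mul_const ((∫ w, |w| ∂F) ^ 2)
    rw [zero_mul] at h3
    refine squeeze_zero' ?_ ?_ h3
    · filter_upwards [eventually_gt_atTop 0] with x hx
      positivity
    · filter_upwards [eventually_gt_atTop 0] with x hx
      have := norm_charFun_sub_one_le hmean (1 / x)
      rw [abs_of_pos (by positivity)] at this
      calc _ ≤ x * Real.exp (g (Real.log x)) * (1 / x * ∫ w, |w| ∂F) ^ 2 := by gcongr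
        _ = _ := by field_simp
  have h4 := (h1.const_mul (-2)).sub h2
  have e2 : -2 * -(c * Real.pi / 2) - 0 = c * Real.pi := by ring
  rw [e2] at h4
  refine h4.congr fun x => ?_
  set z := charFun F (1 / x)
  have e3 : ‖z‖ ^ 2 = 1 + 2 * (z - 1).re + ‖z - 1‖ ^ 2 := by
    rw [← Complex.normSq_eq_norm_sq, ← Complex.normSq_eq_norm_sq, Complex.normSq_apply,
      Complex.normSq_apply]
    simp only [Complex.sub_re, Complex.sub_im, Complex.one_re, Complex.one_im]
    ring
  rw [e3]
  simp only [Function.comp, Complex.add_re, Complex.re_ofReal_mul, Complex.sub_re, Complex.I_re,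
    mul_zero, Complex.one_re]
  ring

/-- Squeeze using `1 - 1/p ≤ log p ≤ p - 1`. -/
lemma tendsto_natCast_mul_one_sub {p : ℕ → ℝ} {a : ℝ} (hp : Tendsto p atTop (𝓝 1))
    (h : Tendsto (fun n => p n ^ n) atTop (𝓝 (Real.exp (-a)))) :
    Tendsto (fun n : ℕ => n * (1 - p n)) atTop (𝓝 a) := by
  have hlog : Tendsto (fun n : ℕ => n * Real.log (p n)) atTop (𝓝 (-a)) := by
    have := ((Real.continuousAt_log (Real.exp_pos (-a)).ne').tendsto).comp h
    rw [Real.log_exp] at this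
    refine this.congr fun n => ?_
    simp [Real.log_pow]
  have h1 : Tendsto (fun n : ℕ => -(p n * (n * Real.log (p n)))) atTop (𝓝 a) := by
    have := (hp.mul hlog).neg
    simpa using this
  have h2 : Tendsto (fun n : ℕ => -(n * Real.log (p n))) atTop (𝓝 a) := by
    simpa using hlog.neg
  refine tendsto_of_tendsto_of_tendsto_of_le_of_le' h1 h2 ?_ ?_
  · filter_upwards [hp.eventually_const_lt one_pos] with n hn
    have h3 := Real.one_sub_inv_le_log_of_pos hn
    have h4 : p n - 1 ≤ p n * Real.log (p n) := by
      have := mul_le_mul_of_nonneg_left h3 hn.le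
      rwa [mul_sub, mul_one, mul_inv_cancel₀ hn.ne'] at this
    have h5 := mul_le_mul_of_nonneg_left h4 (Nat.cast_nonneg (α := ℝ) n)
    linarith
  · filter_upwards [hp.eventually_const_lt one_pos] with n hn
    have h3 := Real.log_le_sub_one_of_pos hn
    have h5 := mul_le_mul_of_nonneg_left h3 (Nat.cast_nonneg (α := ℝ) n)
    linarith

/-- Eventually `n log q ≥ log (a / 2)`, which forces `q ≥ 1 + log (a / 2) / n`. -/
lemma tendsto_one_of_pow {q : ℕ → ℝ} {a : ℝ} (hq0 : ∀ n, 0 ≤ q n) (hq1 : ∀ n, q n ≤ 1)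
    (ha : 0 < a) (h : Tendsto (fun n => q n ^ n) atTop (𝓝 a)) : Tendsto q atTop (𝓝 1) := by
  have h1 : Tendsto (fun n : ℕ => 1 + Real.log (a / 2) / n) atTop (𝓝 1) := by
    simpa using ((tendsto_natCast_atTop_atTop (R := ℝ)).const_div_atTop
      (Real.log (a / 2))).const_add 1
  refine tendsto_of_tendsto_of_tendsto_of_le_of_le' h1 tendsto_const_nhds ?_
    (Eventually.of_forall hq1)
  filter_upwards [h.eventually_const_lt (half_lt_self ha), eventually_gt_atTop 0] with n hn hn0
  have hn1 : (0 : ℝ) < n := by exact_mod_cast hn0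
  have hqpos : 0 < q n := by
    refine (hq0 n).lt_of_ne fun h0 => ?_
    rw [← h0, zero_pow hn0.ne'] at hn
    linarith
  have h3 := Real.log_le_log (half_pos ha) hn.le
  rw [Real.log_pow] at h3
  have h4 := Real.log_le_sub_one_of_pos hqpos
  have h5 : Real.log (a / 2) / n ≤ Real.log (q n) := by
    rw [div_le_iff₀ hn1]; linarith
  linarith

/-- Every scaling sequence tends to infinity and satisfies `n / (Bₙ L(Bₙ)) → 1`. -/
theorem IsNormalizedSlow.scaling_of_isStabilizing (h : IsNormalizedSlow g g' u₀)
    (hpos : F (Set.Iio 0) = 0) (hmean : Integrable (fun x : ℝ => x) F)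
    (htail : ∀ x ≥ Real.exp u₀,
      F.real (Set.Ioi x) = 2 / Real.pi / (x * Real.exp (g (Real.log x))))
    {B A : ℕ → ℝ} (hB : ∀ᶠ n in atTop, 0 < B n)
    (hconv : ∀ t : ℝ, Tendsto (fun n => charFun F (t / B n) ^ n *
      Complex.exp (-((t * A n : ℝ) : ℂ) * Complex.I)) atTop (𝓝 (skewCauchyCharFun t))) :
    Tendsto B atTop atTop ∧
      Tendsto (fun n : ℕ => n / (B n * Real.exp (g (Real.log (B n))))) atTop (𝓝 1) := by
  have hc : 0 ≤ 2 / Real.pi := by positivity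
  have hexp := h.tendsto_one_sub_norm_sq hc hpos hmean htail
  rw [div_mul_cancel₀ _ Real.pi_ne_zero] at hexp
  have hnorm : ∀ t : ℝ, Tendsto (fun n => ‖charFun F (t / B n)‖ ^ n) atTop
      (𝓝 (Real.exp (-|t|))) := by
    intro t
    have h1 := (hconv t).norm
    rw [norm_skewCauchyCharFun] at h1
    refine h1.congr fun n => ?_
    rw [norm_mul, norm_pow, ← Complex.ofReal_neg, Complex.norm_exp_ofReal_mul_I, mul_one]
  have hone : ∀ t, Tendsto (fun n => ‖charFun F (t / B n)‖) atTop (𝓝 1) := fun t =>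
    tendsto_one_of_pow (fun n => norm_nonneg _) (fun n => norm_charFun_le_one _)
      (Real.exp_pos _) (hnorm t)
  have hF : ∃ t, ‖charFun F t‖ ≠ 1 := by
    -- If `‖φ‖` were identically one, this expression would vanish instead of tending to 2.
    obtain ⟨x, hx⟩ := (hexp.eventually_const_lt two_pos).exists
    refine ⟨1 / x, fun h1 => ?_⟩
    rw [h1] at hx
    simp at hx
  have hBtop := tendsto_atTop_of_norm_charFun hB hone hF
  refine ⟨hBtop, ?_⟩
  have hn : Tendsto (fun n : ℕ => n * (1 - ‖charFun F (1 / B n)‖ ^ 2)) atTop (𝓝 2) := by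
    refine tendsto_natCast_mul_one_sub (by simpa using (hone 1).pow 2) ?_
    have h1 := (hnorm 1).pow 2
    have e : Real.exp (-|1|) ^ 2 = Real.exp (-2) := by
      rw [← Real.exp_nat_mul]; norm_num
    rw [e] at h1
    refine h1.congr fun n => ?_
    rw [← pow_mul, ← pow_mul, mul_comm]
  -- Both `n` and `B L(B)`, multiplied by `1 - ‖φ(1/B)‖²`, tend to 2; their quotient gives the
  -- claim.
  have hBn := hexp.comp hBtop
  have hq := hn.div hBn two_ne_zero
  rw [div_self two_ne_zero] at hq
  refine hq.congr' ?_
  filter_upwards [hn.eventually_ne two_ne_zero] with n hne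
  simp only [Pi.div_apply, Function.comp]
  rw [mul_div_mul_right _ _ (right_ne_zero_of_mul hne)]

lemma IsNormalizedSlow.tendsto_charFun_pow_skewCauchy (h : IsNormalizedSlow g g' u₀)
    (hpos : F (Set.Iio 0) = 0) (hmean : Integrable (fun x : ℝ => x) F)
    (htail : ∀ x ≥ Real.exp u₀,
      F.real (Set.Ioi x) = 2 / Real.pi / (x * Real.exp (g (Real.log x))))
    {B : ℕ → ℝ} (hB : Tendsto B atTop atTop)
    (hBn : Tendsto (fun n : ℕ => n / (B n * Real.exp (g (Real.log (B n))))) atTop (𝓝 1)) (t : ℝ) :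
    Tendsto (fun n : ℕ => charFun F (t / B n) ^ n * Complex.exp
      (-((t * tailCentering (2 / Real.pi) g g' F B skewShift n : ℝ) : ℂ) * Complex.I)) atTop
      (𝓝 (skewCauchyCharFun t)) := by
  have h1 := h.tendsto_charFun_pow (by positivity) hpos hmean htail hB hBn skewShift t
  rwa [levyExponent_eq] at h1

lemma exists_eq_mul_one_add {x y : ℕ → ℝ} (h : Tendsto (fun n => x n / y n) atTop (𝓝 1)) :
    ∃ ε : ℕ → ℝ, Tendsto ε atTop (𝓝 0) ∧ ∀ᶠ n in atTop, x n = y n * (1 + ε n) := by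
  refine ⟨fun n => x n / y n - 1, by simpa using h.sub_const 1, ?_⟩
  filter_upwards [h.eventually_ne one_ne_zero] with n hn
  -- Division by zero returns 0, so a ratio near 1 already excludes a zero denominator.
  have : y n ≠ 0 := fun h0 => hn (by rw [h0, div_zero])
  field_simp
  ring

/-- The ratio form of the expansion of the centering sequence. -/
theorem IsNormalizedSlow.tendsto_centering_ratio (h : IsNormalizedSlow g g' u₀)
    (hpos : F (Set.Iio 0) = 0) (hmean : Integrable (fun x : ℝ => x) F)
    (htail : ∀ x ≥ Real.exp u₀,
      F.real (Set.Ioi x) = 2 / Real.pi / (x * Real.exp (g (Real.log x))))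
    {γ κ : ℝ} (hγ : γ < 1) (hκ : 0 < κ)
    (hg' : Tendsto (fun u => u ^ (1 - γ) * (g' u - (1 - γ) / u)) atTop (𝓝 κ))
    (hzero : Tendsto (fun u => u ^ (1 - γ) * Real.exp (-g u)) atTop (𝓝 0))
    {B A : ℕ → ℝ} (hB : Tendsto B atTop atTop)
    (hBn : Tendsto (fun n : ℕ => n / (B n * Real.exp (g (Real.log (B n))))) atTop (𝓝 1))
    (hconv : ∀ t : ℝ, Tendsto (fun n => charFun F (t / B n) ^ n *
      Complex.exp (-((t * A n : ℝ) : ℂ) * Complex.I)) atTop (𝓝 (skewCauchyCharFun t))) :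
    Tendsto (fun n : ℕ => (n * (∫ w, w ∂F) / B n - A n) /
      (2 / Real.pi / κ * (n * Real.log (B n) ^ (1 - γ) /
        (B n * Real.exp (g (Real.log (B n))))))) atTop (𝓝 1) := by
  have hc : 0 < 2 / Real.pi := by positivity
  have hint : IntegrableOn (fun w => w * tailDensity (2 / Real.pi) g g' w)
      (Set.Ioi (Real.exp u₀)) := by
    have := (h.integrable_iff hc.le htail (fun w : ℝ => w)).1.1 hmean.integrableOn
    simpa [mul_comm] using this
  have hd := tendsto_sub_of_charFun skewCauchyCharFun_ne_zero hconv
    (h.tendsto_charFun_pow_skewCauchy hpos hmean htail hB hBn)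
  have hT := (h.tendsto_tailMean_div hint hκ hg' hzero).comp hB
  have hlogB := Real.tendsto_log_atTop.comp hB
  have hpow : Tendsto (fun n => Real.log (B n) ^ (1 - γ)) atTop atTop :=
    (tendsto_rpow_atTop (by linarith)).comp hlogB
  -- Since `γ < 1`, the correction term diverges, and dividing by it removes both the drift
  -- `skewShift` and the `o(1)` ambiguity of the centering.
  have hQ : Tendsto (fun n : ℕ => 2 / Real.pi / κ * (n * Real.log (B n) ^ (1 - γ) /
      (B n * Real.exp (g (Real.log (B n)))))) atTop atTop := by
    have h1 := (hpow.atTop_mul_pos one_pos hBn).const_mul_atTop (div_pos hc hκ)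
    refine h1.congr fun n => ?_
    ring
  have h1 := (hT.div_const (2 / Real.pi / κ)).sub
    ((hd.add_const skewShift).div_atTop hQ)
  rw [div_self (div_pos hc hκ).ne', sub_zero] at h1
  refine h1.congr' ?_
  filter_upwards [hQ.eventually_gt_atTop 0, hpow.eventually_gt_atTop 0,
    hB.eventually_gt_atTop 0, eventually_gt_atTop 0] with n hn hp hb hn0
  have hn1 : (0 : ℝ) < n := by exact_mod_cast hn0
  simp only [Function.comp, tailCentering]
  have := Real.pi_pos
  field_simp
  ring

end Scaling

/-! ### The slowly varying factor -/

/-- The logarithm of `slowFactor` as a function of `log x`. -/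
noncomputable def logSlow (β₀ β₁ δ γ u : ℝ) : ℝ :=
  (δ + 1) * Real.log (β₀ * u) + (if β₁ = 0 then 0 else β₁ ^ γ) * u ^ γ

/-- The derivative of `logSlow`. -/
noncomputable def logSlowDeriv (β₁ δ γ u : ℝ) : ℝ :=
  (δ + 1) / u + (if β₁ = 0 then 0 else β₁ ^ γ) * (γ * u ^ (γ - 1))

section SlowFactor

variable {β₀ β₁ δ γ : ℝ}

lemma slowFactor_eq_exp (hβ₀ : 0 < β₀) (hβ₁ : 0 ≤ β₁) {x : ℝ} (hx : 0 < Real.log x) :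
    slowFactor β₀ β₁ δ γ x = Real.exp (logSlow β₀ β₁ δ γ (Real.log x)) := by
  rw [slowFactor, logSlow, Real.exp_add, Real.rpow_def_of_pos (mul_pos hβ₀ hx)]
  congr 2
  · ring
  · split_ifs
    · simp
    · rw [Real.mul_rpow hβ₁ hx.le]

lemma hasDerivAt_logSlow (hβ₀ : 0 < β₀) {u : ℝ} (hu : 0 < u) :
    HasDerivAt (logSlow β₀ β₁ δ γ) (logSlowDeriv β₁ δ γ u) u := by
  have h1 : HasDerivAt (fun u => Real.log (β₀ * u)) (β₀ * 1 / (β₀ * u)) u :=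
    ((hasDerivAt_id u).const_mul β₀).log (mul_pos hβ₀ hu).ne'
  have h2 := (h1.const_mul (δ + 1)).add ((Real.hasDerivAt_rpow_const (p := γ)
    (Or.inl hu.ne')).const_mul (if β₁ = 0 then 0 else β₁ ^ γ))
  refine h2.congr_deriv ?_
  rw [logSlowDeriv]
  field_simp

lemma continuousOn_logSlowDeriv : ContinuousOn (logSlowDeriv β₁ δ γ) (Set.Ioi 0) := by
  refine (continuousOn_const.div continuousOn_id fun u hu => (ne_of_gt hu)).add
    (continuousOn_const.mul (continuousOn_const.mul ?_))
  exact continuousOn_id.rpow_const fun u hu => Or.inl (ne_of_gt hu)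

lemma tendsto_logSlowDeriv (hγ : γ < 1) : Tendsto (logSlowDeriv β₁ δ γ) atTop (𝓝 0) := by
  have h1 := tendsto_rpow_neg_atTop (y := 1 - γ) (by linarith)
  rw [neg_sub] at h1
  have h2 := (tendsto_id.const_div_atTop (δ + 1)).add
    ((h1.const_mul γ).const_mul (if β₁ = 0 then 0 else β₁ ^ γ))
  simp only [mul_zero, add_zero] at h2
  exact h2

lemma eventually_isNormalizedSlow (hβ₀ : 0 < β₀) (hγ : γ < 1) :
    ∀ᶠ u₀ in atTop, IsNormalizedSlow (logSlow β₀ β₁ δ γ) (logSlowDeriv β₁ δ γ) u₀ := by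
  have h1 := (tendsto_logSlowDeriv (β₁ := β₁) (δ := δ) hγ).abs
  rw [abs_zero] at h1
  filter_upwards [eventually_gt_atTop 0,
    eventually_forall_ge_atTop.2 (h1.eventually_lt_const (half_pos one_pos))] with u₀ h0 hb
  exact ⟨fun u hu => hasDerivAt_logSlow hβ₀ (h0.trans_le hu),
    continuousOn_logSlowDeriv.mono fun u hu => h0.trans_le hu,
    fun u hu => (hb u hu).le, tendsto_logSlowDeriv hγ⟩

/-- In case (a) the expression equals `(δ + γ) u ^ (-γ) + β₁ ^ γ γ`, and the power part dies. In
case (b) it is exactly `δ`. This is the source of the two forms of the constant. -/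
lemma tendsto_rpow_mul_logSlowDeriv {κ : ℝ}
    (hpar : (0 < β₁ ∧ 0 < γ ∧ γ < 1 ∧ κ = β₁ ^ γ * γ) ∨ (β₁ = 0 ∧ γ = 0 ∧ 0 < δ ∧ κ = δ)) :
    Tendsto (fun u => u ^ (1 - γ) * (logSlowDeriv β₁ δ γ u - (1 - γ) / u)) atTop (𝓝 κ) := by
  rcases hpar with ⟨hβ, hγ0, hγ1, rfl⟩ | ⟨rfl, rfl, hδ, rfl⟩
  · have h1 := ((tendsto_rpow_neg_atTop hγ0).const_mul (δ + γ)).add_const (β₁ ^ γ * γ)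
    rw [mul_zero, zero_add] at h1
    refine h1.congr' ?_
    filter_upwards [eventually_gt_atTop 0] with u hu
    rw [logSlowDeriv, if_neg hβ.ne', Real.rpow_sub hu, Real.rpow_sub hu, Real.rpow_neg hu.le,
      Real.rpow_one]
    have := (Real.rpow_pos_of_pos hu γ).ne'
    field_simp
    ring
  · refine tendsto_const_nhds.congr' ?_
    filter_upwards [eventually_gt_atTop 0] with u hu
    simp only [logSlowDeriv, if_true, sub_zero, Real.rpow_one]
    field_simp
    ring

/-- Up to a constant this is `u ^ (-(δ + γ)) exp (-β₁ ^ γ u ^ γ)` in case (a), where the exponential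
wins whatever the sign of `δ`, and `u ^ (-δ)` in case (b). -/
lemma tendsto_rpow_mul_exp_neg_logSlow (hβ₀ : 0 < β₀)
    (hpar : (0 < β₁ ∧ 0 < γ ∧ γ < 1) ∨ (β₁ = 0 ∧ γ = 0 ∧ 0 < δ)) :
    Tendsto (fun u => u ^ (1 - γ) * Real.exp (-logSlow β₀ β₁ δ γ u)) atTop (𝓝 0) := by
  have key : ∀ u : ℝ, 0 < u → u ^ (1 - γ) * Real.exp (-logSlow β₀ β₁ δ γ u) =
      β₀ ^ (-(δ + 1)) * (u ^ (-(δ + γ)) *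
        Real.exp (-(if β₁ = 0 then 0 else β₁ ^ γ) * u ^ γ)) := by
    intro u hu
    have e1 : Real.exp (-logSlow β₀ β₁ δ γ u) = β₀ ^ (-(δ + 1)) * u ^ (-(δ + 1)) *
        Real.exp (-(if β₁ = 0 then 0 else β₁ ^ γ) * u ^ γ) := by
      rw [← Real.mul_rpow hβ₀.le hu.le, Real.rpow_def_of_pos (mul_pos hβ₀ hu), ← Real.exp_add,
        logSlow]
      congr 1; ring
    have e2 : u ^ (-(δ + γ)) = u ^ (1 - γ) * u ^ (-(δ + 1)) := by
      rw [← Real.rpow_add hu]; congr 1; ring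
    rw [e1, e2]; ring
  have hlim : Tendsto (fun u : ℝ => u ^ (-(δ + γ)) *
      Real.exp (-(if β₁ = 0 then 0 else β₁ ^ γ) * u ^ γ)) atTop (𝓝 0) := by
    rcases hpar with ⟨hβ, hγ0, hγ1⟩ | ⟨rfl, rfl, hδ⟩
    · rw [if_neg hβ.ne']
      -- The variable is `v = u ^ γ`, hence the exponent `-(δ + γ) / γ`.
      have h1 := (tendsto_rpow_mul_exp_neg_mul_atTop_nhds_zero (-(δ + γ) / γ) (β₁ ^ γ)
        (Real.rpow_pos_of_pos hβ γ)).comp (tendsto_rpow_atTop hγ0)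
      refine h1.congr' ?_
      filter_upwards [eventually_gt_atTop 0] with u hu
      simp only [Function.comp]
      rw [← Real.rpow_mul hu.le, mul_div_cancel₀ _ hγ0.ne']
    · simpa using tendsto_rpow_neg_atTop hδ
  have h1 := hlim.const_mul (β₀ ^ (-(δ + 1)))
  rw [mul_zero] at h1
  refine h1.congr' ?_
  filter_upwards [eventually_gt_atTop 0] with u hu
  exact (key u hu).symm

end SlowFactor

/-! ### The de Bruijn conjugate -/

/-- By the intermediate value theorem every large `z` is `G x` with `x` large, so a limit in `z` may
be tested along `z = G x`. -/
lemma atTop_le_map_of_continuousOn {G : ℝ → ℝ} {a : ℝ} (hc : ContinuousOn G (Set.Ici a))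
    (hG : Tendsto G atTop atTop) : (atTop : Filter ℝ) ≤ map G atTop := by
  intro s hs
  obtain ⟨R, hR⟩ := mem_atTop_sets.1 (mem_map.1 hs)
  refine mem_atTop_sets.2 ⟨G (max R a), fun z hz => ?_⟩
  obtain ⟨y, hy1, hy2⟩ := ((hG.eventually_ge_atTop z).and (eventually_ge_atTop (max R a))).exists
  have hsub : Set.Icc (max R a) y ⊆ Set.Ici a := fun w hw => (le_max_right R a).trans hw.1
  obtain ⟨x, hx, rfl⟩ := intermediate_value_Icc hy2 (hc.mono hsub) ⟨hz, hy1⟩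
  exact hR x ((le_max_left R a).trans hx.1)

section Conjugate

variable {g g' : ℝ → ℝ} {u₀ : ℝ} {L M : ℝ → ℝ}

lemma IsNormalizedSlow.atTop_le_map (h : IsNormalizedSlow g g' u₀) :
    (atTop : Filter ℝ) ≤ map (fun x => x * Real.exp (g (Real.log x))) atTop := by
  refine atTop_le_map_of_continuousOn (a := Real.exp u₀) ?_ h.tendsto_mul_slow
  exact continuousOn_id.mul fun x hx => (h.hasDerivAt_slow hx).continuousAt.continuousWithinAt

/-- `z M(z) → ∞` and `log (z M(z)) / log z → 1` for a de Bruijn conjugate `M`. -/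
theorem IsNormalizedSlow.conjugate_asymptotics (h : IsNormalizedSlow g g' u₀)
    (hL : ∀ᶠ x in atTop, L x = Real.exp (g (Real.log x)))
    (hM : Tendsto (fun x => M (x * L x) * L x) atTop (𝓝 1)) :
    Tendsto (fun z => z * M z) atTop atTop ∧
      Tendsto (fun z => Real.log (z * M z) / Real.log z) atTop (𝓝 1) := by
  have hρ : Tendsto (fun x => M (x * Real.exp (g (Real.log x))) * Real.exp (g (Real.log x)))
      atTop (𝓝 1) := by
    refine hM.congr' ?_
    filter_upwards [hL] with x hx
    rw [hx]
  constructor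
  · refine Tendsto.mono_left ?_ h.atTop_le_map
    rw [tendsto_map'_iff]
    refine (tendsto_id.atTop_mul_pos one_pos hρ).congr fun x => ?_
    simp only [Function.comp, id]
    ring
  · refine Tendsto.mono_left ?_ h.atTop_le_map
    rw [tendsto_map'_iff]
    have hlogρ := ((Real.continuousAt_log one_ne_zero).tendsto.comp hρ)
    rw [Real.log_one] at hlogρ
    have hlog := Real.tendsto_log_atTop
    -- Here `log z = log x + g (log x)` and `g (u) / u → 0`, so `log (z M(z))` and `log z` are both
    -- asymptotic to `log x`.
    have h1 := ((hlogρ.div_atTop hlog).const_add 1).div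
      ((h.tendsto_div_id.comp hlog).const_add 1) (by simp)
    rw [add_zero, div_one] at h1
    refine h1.congr' ?_
    filter_upwards [hlog.eventually_gt_atTop 0, eventually_gt_atTop 0,
      hρ.eventually_const_lt one_pos] with x hx hx0 hp
    have hM0 : 0 < M (x * Real.exp (g (Real.log x))) := pos_of_mul_pos_left hp (Real.exp_pos _).le
    simp only [Pi.div_apply, Function.comp]
    have e1 : x * Real.exp (g (Real.log x)) * M (x * Real.exp (g (Real.log x))) =
        x * (M (x * Real.exp (g (Real.log x))) * Real.exp (g (Real.log x))) := by ring
    rw [e1, Real.log_mul hx0.ne' hp.ne', Real.log_mul hx0.ne' (Real.exp_pos _).ne', Real.log_exp]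
    have hx' := hx.ne'
    field_simp

end Conjugate

/-! ### The centering expansions -/

theorem mainTheorem7
    (β₀ β₁ δ γ : ℝ) (hβ₀ : 0 < β₀)
    (hpar : (0 < β₁ ∧ 0 < γ ∧ γ < 1) ∨ (β₁ = 0 ∧ γ = 0 ∧ 0 < δ))
    -- a finite-mean distribution on the positive half-line with the prescribed right tail
    (F : Measure ℝ) [IsProbabilityMeasure F] (hpos : F (Set.Iio 0) = 0)
    (hmean : Integrable (fun x : ℝ => x) F)
    (htail : ∀ᶠ x : ℝ in atTop,
      F.real (Set.Ioi x) = (2 / Real.pi) / (x * slowFactor β₀ β₁ δ γ x))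
    -- an i.i.d. sequence with distribution `F`
    {Ω : Type*} [MeasurableSpace Ω] (P : Measure Ω) [IsProbabilityMeasure P]
    (X : ℕ → Ω → ℝ) (hindep : iIndepFun X P) (hlaw : ∀ i, HasLaw (X i) F P)
    -- a version of the de Bruijn conjugate of `L`
    (Ldag : ℝ → ℝ) (hdag : IsDeBruijnConjugate (slowFactor β₀ β₁ δ γ) Ldag) :
    -- centering in terms of an arbitrary scaling sequence
    (∀ B A : ℕ → ℝ, IsStabilizing P X B A →
      ∃ ε : ℕ → ℝ, Tendsto ε atTop (𝓝 0) ∧ ∀ᶠ n : ℕ in atTop,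
        A n = n * (∫ x, x ∂F) / B n
          - centeringConst δ γ β₁ * (n * Real.log (B n) ^ (1 - γ) /
              (B n * slowFactor β₀ β₁ δ γ (B n))) * (1 + ε n)) ∧
    -- `n * Ldag n` is a scaling sequence
    (∃ A : ℕ → ℝ, IsStabilizing P X (fun n => n * Ldag n) A) ∧
    -- every centering sequence that goes with it has the two expansions
    (∀ A : ℕ → ℝ, IsStabilizing P X (fun n => n * Ldag n) A →
      (∃ ε : ℕ → ℝ, Tendsto ε atTop (𝓝 0) ∧ ∀ᶠ n : ℕ in atTop,
        A n = (∫ x, x ∂F) / Ldag n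
          - centeringConst δ γ β₁ * (Real.log (n * Ldag n) ^ (1 - γ) /
              (Ldag n * slowFactor β₀ β₁ δ γ (n * Ldag n))) * (1 + ε n)) ∧
      (∃ ε : ℕ → ℝ, Tendsto ε atTop (𝓝 0) ∧ ∀ᶠ n : ℕ in atTop,
        A n = (∫ x, x ∂F) / Ldag n
          - centeringConst δ γ β₁ * Real.log n ^ (1 - γ) * (1 + ε n))) := by
  have hβ₁ : 0 ≤ β₁ := by rcases hpar with h | h <;> linarith [h.1]
  have hγ : γ < 1 := by
    rcases hpar with h | h
    · exact h.2.2
    · linarith [h.2.1]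
  obtain ⟨κ, hκ, hKκ, hparκ⟩ : ∃ κ : ℝ, 0 < κ ∧ centeringConst δ γ β₁ = 2 / Real.pi / κ ∧
      ((0 < β₁ ∧ 0 < γ ∧ γ < 1 ∧ κ = β₁ ^ γ * γ) ∨ (β₁ = 0 ∧ γ = 0 ∧ 0 < δ ∧ κ = δ)) := by
    rcases hpar with ⟨h1, h2, h3⟩ | ⟨h1, h2, h3⟩
    · exact ⟨β₁ ^ γ * γ, mul_pos (Real.rpow_pos_of_pos h1 γ) h2,
        by rw [centeringConst, if_neg h1.ne'], Or.inl ⟨h1, h2, h3, rfl⟩⟩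
    · exact ⟨δ, h3, by rw [centeringConst, if_pos h1], Or.inr ⟨h1, h2, h3, rfl⟩⟩
  set g := logSlow β₀ β₁ δ γ with hg
  set g' := logSlowDeriv β₁ δ γ with hg'
  have hslow : ∀ᶠ x : ℝ in atTop, slowFactor β₀ β₁ δ γ x = Real.exp (g (Real.log x)) := by
    filter_upwards [Real.tendsto_log_atTop.eventually_gt_atTop 0] with x hx
    exact slowFactor_eq_exp hβ₀ hβ₁ hx
  obtain ⟨u₀, h, htail'⟩ : ∃ u₀, IsNormalizedSlow g g' u₀ ∧ ∀ x ≥ Real.exp u₀,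
      F.real (Set.Ioi x) = 2 / Real.pi / (x * Real.exp (g (Real.log x))) := by
    have h1 : ∀ᶠ x : ℝ in atTop,
        F.real (Set.Ioi x) = 2 / Real.pi / (x * Real.exp (g (Real.log x))) := by
      filter_upwards [htail, hslow] with x h1 h2
      rw [h1, h2]
    exact ((eventually_isNormalizedSlow hβ₀ hγ).and
      (Real.tendsto_exp_atTop.eventually (eventually_forall_ge_atTop.2 h1))).exists
  have hratio := fun {B A : ℕ → ℝ} => h.tendsto_centering_ratio (B := B) (A := A) hpos hmean htail'
    hγ hκ (tendsto_rpow_mul_logSlowDeriv hparκ) (tendsto_rpow_mul_exp_neg_logSlow hβ₀ hpar)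
  -- the sequence `n * Ldag n`
  obtain ⟨hz1, hz2⟩ := h.conjugate_asymptotics hslow hdag.2.2
  have hBtop : Tendsto (fun n : ℕ => (n : ℝ) * Ldag n) atTop atTop :=
    hz1.comp tendsto_natCast_atTop_atTop
  have hLM : Tendsto (fun n : ℕ => slowFactor β₀ β₁ δ γ (n * Ldag n) * Ldag n) atTop (𝓝 1) :=
    hdag.2.1.comp (tendsto_natCast_atTop_atTop (R := ℝ))
  -- This ratio is the reciprocal of `L(n L†(n)) L†(n)`.
  have hBn : Tendsto (fun n : ℕ => (n : ℝ) /
      (n * Ldag n * Real.exp (g (Real.log (n * Ldag n))))) atTop (𝓝 1) := by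
    have h1 := hLM.inv₀ one_ne_zero
    rw [inv_one] at h1
    refine h1.congr' ?_
    filter_upwards [hBtop.eventually hslow, eventually_gt_atTop 0] with n hn hn0
    have hn1 : (n : ℝ) ≠ 0 := by exact_mod_cast hn0.ne'
    rw [hn, mul_assoc, div_mul_cancel_left₀ hn1, mul_comm]
  refine ⟨fun B A hBA => ?_, ?_, fun A hA => ?_⟩
  · obtain ⟨hB, hconv⟩ := (isStabilizing_iff hindep hlaw).1 hBA
    obtain ⟨hB1, hB2⟩ := h.scaling_of_isStabilizing hpos hmean htail' hB hconv
    obtain ⟨ε, hε, he⟩ := exists_eq_mul_one_add (hratio hB1 hB2 hconv)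
    refine ⟨ε, hε, ?_⟩
    filter_upwards [he, hB1.eventually hslow] with n h1 h2
    rw [h2, hKκ]
    linarith
  · exact ⟨_, (isStabilizing_iff hindep hlaw).2 ⟨hBtop.eventually_gt_atTop 0,
      h.tendsto_charFun_pow_skewCauchy hpos hmean htail' hBtop hBn⟩⟩
  · obtain ⟨-, hconv⟩ := (isStabilizing_iff hindep hlaw).1 hA
    have hr := hratio hBtop hBn hconv
    constructor
    · obtain ⟨ε, hε, he⟩ := exists_eq_mul_one_add hr
      refine ⟨ε, hε, ?_⟩
      filter_upwards [he, hBtop.eventually hslow, eventually_gt_atTop 0] with n h1 h2 hn0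
      have hn1 : (n : ℝ) ≠ 0 := by exact_mod_cast hn0.ne'
      rw [mul_div_mul_left _ _ hn1, mul_assoc (n : ℝ), mul_div_mul_left _ _ hn1] at h1
      rw [h2, hKκ]
      linarith
    · have hpow : Tendsto (fun n : ℕ => (Real.log (n * Ldag n) / Real.log n) ^ (1 - γ)) atTop
          (𝓝 1) := by
        have h1 := (hz2.comp (tendsto_natCast_atTop_atTop (R := ℝ))).rpow_const
          (p := 1 - γ) (Or.inl one_ne_zero)
        rwa [Real.one_rpow] at h1
      -- Two factors tending to one trade `log B` for `log n` and remove `n / (B L(B))` from the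
      -- denominator.
      have hr2 := (hr.mul hpow).mul hBn
      rw [one_mul, one_mul] at hr2
      have hr3 : Tendsto (fun n : ℕ => ((∫ x, x ∂F) / Ldag n - A n) /
          (centeringConst δ γ β₁ * Real.log n ^ (1 - γ))) atTop (𝓝 1) := by
        refine hr2.congr' ?_
        filter_upwards [eventually_gt_atTop 0, hBn.eventually_ne one_ne_zero,
          (Real.tendsto_log_atTop.comp hBtop).eventually_gt_atTop 0,
          (Real.tendsto_log_atTop.comp
            (tendsto_natCast_atTop_atTop (R := ℝ))).eventually_gt_atTop 0] with n hn0 h2 h3 h4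
        have hn1 : (n : ℝ) ≠ 0 := by exact_mod_cast hn0.ne'
        simp only [Function.comp] at h3 h4
        have hp3 := (Real.rpow_pos_of_pos h3 (1 - γ)).ne'
        have hp4 := (Real.rpow_pos_of_pos h4 (1 - γ)).ne'
        rw [mul_div_mul_left _ _ hn1, hKκ, Real.div_rpow h3.le h4.le, mul_div_right_comm (n : ℝ)]
        generalize (n : ℝ) / (n * Ldag n * Real.exp (g (Real.log (n * Ldag n)))) = q at *
        generalize (∫ x, x ∂F) / Ldag n - A n = s
        have := Real.pi_ne_zero
        field_simp
      obtain ⟨ε, hε, he⟩ := exists_eq_mul_one_add hr3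
      refine ⟨ε, hε, ?_⟩
      filter_upwards [he] with n h1
      linarith
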